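/- Let $K\ge 2$ and consider the frequency-selective $K$-user Gaussian interference channel with confidential messages: with transmissions over $n\ge1$ time slots and $F\ge1$ frequency slots, receiver $i$ observes $$Y_i(f,t)=\sum_{k=1}^K h_{ik}(f)X_k(f,t)+Z_i(f,t),\qquad 1\le t\le n,\ 1\le f\le F,$$ where the noises $Z_i(f,t)$ are i.i.d. $\mathcal{CN}(0,1)$. The complex channel coefficients $h_{ik}(f)$ ($i,k\in\mathcal K=\{1,\dots,K\}$, $f=1,2,\dots$) are random, fixed during the communication, known to all nodes, and drawn from a continuous distribution in the following sense: for every $F$, the joint law of $(h_{ik}(f))_{i,k\in\mathcal K,\,f\le F}$ is absolutely continuous with respect to a product of atomless $\sigma$-finite measures on $\mathbb C$ (for instance, the coefficients are independent with atomless laws, or they have joint densities). An $(n,F,M_1,\dots,M_K)$ secret codebook consists, for each user $k$, of a message set $\{1,\dots,M_k\}$, a stochastic encoder assigning to each message a probability law on codewords $X_k\in\mathbb C^{nF}$, with independent randomization at different users, and a (measurable) decoder $\phi_k$ mapping $Y_k$ to an estimate of the message $W_k$. It satisfies the power constraint $\rho$ if $\frac1{nF}\sum_{f,t}|X_k(f,t)|^2\le\rho$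 almost surely for each message and each user. The messages $W_1,\dots,W_K$ are independent and uniform; $P_{e,k}=\Pr\{\phi_k(Y_k)\ne W_k\}$; and for $\mathcal S\subseteq\mathcal K\setminus\{i\}$ put $\Delta_{\mathcal S,i}=H(W_{\mathcal S}\mid Y_i)/H(W_{\mathcal S})$ (equal to $1$ if $H(W_{\mathcal S})=0$). For a given channel realization and power $\rho$, the tuple $(R_1,\dots,R_K,d)$ is achievable if for every $\epsilon>0$ there are $n,F,M_1,\dots,M_K$ and an $(n,F,M_1,\dots,M_K)$ secret codebook with power constraint $\rho$ such that $\frac1{nF}\log_2M_k=R_k$ and $P_{e,k}\le\epsilon$ for all $k$, and $\Delta_{\mathcal S,i}\ge d-\epsilon$ for all $i$ and all $\mathcal S\subseteq\mathcal K\setminus\{i\}$. The symmetric secure degrees of freedom $\eta$ per frequency-time slot are achievable if there are rates $R(\rho)$, $\rho>0$, such that $(R(\rho),\dots,R(\rho),1)$ is achievable at every power $\rho>0$ and $\lim_{\rho\to\infty}R(\rho)/\log_2\rho=\eta$. Then, for almost every realization of the channel coefficients, the symmetric secure degrees of freedom $$\eta=\frac{K-2}{2K-2}$$ are achievable. -/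

import Mathlib

open MeasureTheory ProbabilityTheory Filter Topology

noncomputable section

namespace SecrecyIC

/-! ### Entropy of finitely valued random variables, in bits -/

/-- The entropy `H(X)` of a random variable `X` with values in a finite set. -/
def entropy {Ω A : Type*} [MeasurableSpace Ω] [Fintype A] (μ : Measure Ω) (X : Ω → A) : ℝ :=
  ∑ a : A, Real.negMulLog (μ.real (X ⁻¹' {a})) / Real.log 2

/-- The conditional entropy `H(X | Y) = E[-∑ a, P(X = a | Y) log₂ P(X = a | Y)]` of a finitely
valued `X` given an arbitrary random variable `Y`; here `P(X = a | Y)` is the conditional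
probability given the σ-algebra generated by `Y`. -/
def condEntropy {Ω A B : Type*} [MeasurableSpace Ω] [Fintype A] [mB : MeasurableSpace B]
    (μ : Measure Ω) (X : Ω → A) (Y : Ω → B) : ℝ :=
  ∫ ω, ∑ a : A, Real.negMulLog
    ((μ[(X ⁻¹' {a}).indicator (fun _ => (1 : ℝ)) | mB.comap Y]) ω) / Real.log 2 ∂μ

/-! ### The channel -/

/-- Coefficients of a `K`-user interference channel: `h i k f` is the gain from transmitter `k`
to receiver `i` in frequency slot `f`. A system with `F` slots uses the slots `f < F`. -/
abbrev Channel (K : ℕ) : Type := Fin K → Fin K → ℕ → ℂ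

/-- Signals over `n` time slots and `F` frequency slots. -/
abbrev Signal (n F : ℕ) : Type := Fin n → Fin F → ℂ

/-- The circularly symmetric complex Gaussian law `CN(0,1)`: independent real and imaginary
parts, each `N(0,1/2)`. -/
def complexGaussian : Measure ℂ :=
  ((gaussianReal 0 (1 / 2)).prod (gaussianReal 0 (1 / 2))).map (fun p => (⟨p.1, p.2⟩ : ℂ))

/-- White noise: independent `CN(0,1)` entries. -/
def noise (n F : ℕ) : Measure (Signal n F) :=
  Measure.pi fun _ => Measure.pi fun _ => complexGaussian

/-- The signal at receiver `i`, for transmitted signals `x` and noise `z`. -/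
def received {K n F : ℕ} (h : Channel K) (i : Fin K) (x : Fin K → Signal n F)
    (z : Signal n F) : Signal n F :=
  fun t f => ∑ k, h i k f * x k t f + z t f

/-- The channel coefficients are drawn from a continuous distribution: for every number `F` of
slots, their joint law is absolutely continuous with respect to a product of atomless σ-finite
measures. This holds for independent coefficients with atomless laws (the product of the laws)
and for coefficients with a joint density (the product of Lebesgue measures). -/
def ContinuouslyDistributed {Ω : Type*} [MeasurableSpace Ω] (P : Measure Ω) {K : ℕ}
    (h : Fin K → Fin K → ℕ → Ω → ℂ) : Prop :=
  ∀ F : ℕ, ∃ ν : Fin K × Fin K × Fin F → Measure ℂ,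
    (∀ j, SigmaFinite (ν j)) ∧ (∀ j, NullSingletonClass (ν j)) ∧
      P.map (fun ω j => h j.1 j.2.1 j.2.2 ω) ≪ Measure.pi ν

/-! ### Codebooks -/

/-- An `(n, F, M₁, …, M_K)` secret codebook: stochastic encoders (`enc k w` is the law of the
codeword that transmitter `k` sends for its message `w`) and measurable decoders. -/
structure SecretCodebook (K n F : ℕ) (M : Fin K → ℕ) where
  enc : (k : Fin K) → Fin (M k) → Measure (Signal n F)
  enc_prob : ∀ k w, IsProbabilityMeasure (enc k w)
  dec : (k : Fin K) → Signal n F → Fin (M k)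
  dec_measurable : ∀ k, Measurable (dec k)

namespace SecretCodebook

variable {K n F : ℕ} {M : Fin K → ℕ}

/-- Every transmitted codeword has average power at most `ρ`. -/
def PowerConstraint (C : SecretCodebook K n F M) (ρ : ℝ) : Prop :=
  ∀ k w, ∀ᵐ x ∂(C.enc k w), (1 / ((n : ℝ) * F)) * ∑ f, ∑ t, ‖x t f‖ ^ 2 ≤ ρ

/-- The law of the output at receiver `i`, given that the messages `w` are sent. The encoders
randomize independently of each other and of the noise. -/
def outputLaw (C : SecretCodebook K n F M) (h : Channel K) (i : Fin K)
    (w : (k : Fin K) → Fin (M k)) : Measure (Signal n F) :=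
  ((Measure.pi fun k => C.enc k (w k)).prod (noise n F)).map fun p => received h i p.1 p.2

/-- The probability of error at receiver `k`, averaged over all message tuples. -/
def errorProb (C : SecretCodebook K n F M) (h : Channel K) (k : Fin K) : ℝ :=
  (1 / ∏ i, (M i : ℝ)) *
    ∑ w : (i : Fin K) → Fin (M i), (C.outputLaw h k w).real {y | C.dec k y ≠ w k}

/-- The joint law of the (independent, uniform) messages and of the output at receiver `i`. -/
def jointLaw (C : SecretCodebook K n F M) (h : Channel K) (i : Fin K) :
    Measure (((k : Fin K) → Fin (M k)) × Signal n F) :=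
  (∏ k, (M k : ENNReal))⁻¹ •
    ∑ w : (k : Fin K) → Fin (M k), (C.outputLaw h i w).map (fun y => (w, y))

/-- The messages of the users in `S`. -/
def messages (S : Finset (Fin K)) (p : ((k : Fin K) → Fin (M k)) × Signal n F) :
    (k : S) → Fin (M k) :=
  fun k => p.1 k

/-- The normalized equivocation `H(W_S | Y_i) / H(W_S)` of the messages of `S` at receiver `i`.
If `H(W_S) = 0` there is nothing to hide, and the value is `1`. -/
def equivocation (C : SecretCodebook K n F M) (h : Channel K) (S : Finset (Fin K))
    (i : Fin K) : ℝ :=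
  if entropy (C.jointLaw h i) (messages S) = 0 then 1
  else condEntropy (C.jointLaw h i) (messages S) Prod.snd /
    entropy (C.jointLaw h i) (messages S)

end SecretCodebook

/-! ### Achievability -/

/-- The rate-equivocation tuple `(R₁, …, R_K, d)` is achievable under the power constraint `ρ`
on the channel `h` with confidential messages. -/
def Achievable {K : ℕ} (h : Channel K) (ρ : ℝ) (R : Fin K → ℝ) (d : ℝ) : Prop :=
  ∀ ε : ℝ, 0 < ε → ∃ (n F : ℕ) (M : Fin K → ℕ) (C : SecretCodebook K n F M),
    0 < n ∧ 0 < F ∧ C.PowerConstraint ρ ∧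
    (∀ k, (1 / ((n : ℝ) * F)) * Real.logb 2 (M k) = R k) ∧
    (∀ k, C.errorProb h k ≤ ε) ∧
    (∀ i : Fin K, ∀ S : Finset (Fin K), i ∉ S → d - ε ≤ C.equivocation h S i)

/-- The symmetric degrees of freedom `η` (per frequency-time slot) are achievable with perfect
secrecy on the channel `h`: at every power `ρ` a common rate `R ρ` is achievable for all users
with `d = 1`, and `R ρ / log₂ ρ → η` as `ρ → ∞`. -/
def SecureDoFAchievable {K : ℕ} (h : Channel K) (η : ℝ) : Prop :=
  ∃ R : ℝ → ℝ, (∀ ρ : ℝ, 0 < ρ → Achievable h ρ (fun _ => R ρ) 1) ∧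
    Tendsto (fun ρ => R ρ / Real.logb 2 ρ) atTop (𝓝 η)

end SecrecyIC

end

/-!
The transmitters use interference alignment on an integer lattice, protected by an outer code and
by random binning.

*Alignment.* All users send along the same beams `v α`, whose entries in slot `f` are the monomials
`∏ h i j f ^ α (i, j)` in the cross gains (`i ≠ j`) with exponents below `m`. A cross channel
multiplies such a beam by one more gain, so at every receiver all interference lies along the
monomials with exponents at most `m`, and each interfering beam falls exactly on one of these. The
desired beams carry the additional factor `h i i f`. The matrix of all beams at a receiver is thus a
generalized alternant of distinct monomials; its determinant is a nonzero polynomial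
(`det_monomial_ne_zero`), and a nonzero polynomial vanishes only on a null set of a product of
atomless measures (`ae_eval_ne_zero`). Hence almost surely, for all `m`, a receiver separates the
desired symbols from the interference (`ae_hasAlignment`). For `m → ∞` both fill half of the space.

*Reliability.* The symbols on the beams are Gaussian integers with coordinates in `{0, …, 2 ^ s - 1}`
scaled by a constant `c`, so that after zero forcing and rounding a time slot is wrong with a small
fixed probability. An outer code of large Hamming distance (`exists_code`) over the symbol vectors
of `n` slots corrects these errors at a small loss of rate, with error probability tending to `0`.

*Secrecy.* By alignment, receiver `i` observes the other users only through the integer sums of the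
symbols on aligned beams (`received_modulate`). These sums take few values: about as many as one
user has symbol vectors. The codeword indices `(w, r)` consist of a message `w` and of uniform
randomness `r` and are scrambled by a permutation for each user. Given `r` in sufficient amount,
a second moment computation over random permutations shows that the law of the sums hardly depends
on the messages (`sum_leakage_sq_le`, `exists_binning`). The point is that, given the codewords of
the remaining users, the sums determine a codeword, which makes collisions rare. Total variation
bounds turn into bounds for the conditional entropy by `condEntropy_ge` and `equivocation_ge`.

*Rates.* A user has about `2 s` bits per beam and slot, and the other `K - 1` users together have to
spend about the same amount on randomness to fill the sums. This leaves the fraction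
`1 - 1 / (K - 1)` of the rate `F / 2 * log₂ ρ` per time slot (`exists_const_achievable`).
-/

noncomputable section

namespace SecrecyIC

/-! ### Zeros of polynomials in continuously distributed variables -/

theorem ae_eval_ne_zero_fin {n : ℕ} (ν : Fin n → Measure ℂ) [∀ j, SigmaFinite (ν j)]
    [∀ j, NullSingletonClass (ν j)] (p : MvPolynomial (Fin n) ℂ) (hp : p ≠ 0) :
    ∀ᵐ x ∂(Measure.pi ν), MvPolynomial.eval x p ≠ 0 := by
  induction n with
  | zero =>
    refine Eventually.of_forall fun x hx => hp ?_
    rw [MvPolynomial.eq_C_of_isEmpty p] at hx ⊢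
    rw [MvPolynomial.eval_C] at hx
    rw [hx, MvPolynomial.C_0]
  | succ n ih =>
    have hmeas : MeasurableSet {x : Fin (n + 1) → ℂ | MvPolynomial.eval x p = 0} :=
      (isClosed_singleton.preimage (MvPolynomial.continuous_eval p)).measurableSet
    set q := MvPolynomial.finSuccEquiv ℂ n p with hq
    have hq0 : q ≠ 0 := by
      rw [hq]; exact (map_ne_zero_iff _ (MvPolynomial.finSuccEquiv ℂ n).injective).2 hp
    have hlead := ih (fun j => ν j.succ) q.leadingCoeff (Polynomial.leadingCoeff_ne_zero.2 hq0)
    have hmp := (measurePreserving_piFinSuccAbove ν 0).symm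
    rw [ae_iff]
    simp only [not_not]
    rw [← hmp.measure_preimage hmeas.nullMeasurableSet,
      Measure.prod_apply_symm (hmp.measurable hmeas), lintegral_eq_zero_iff' ?_]
    · filter_upwards [hlead] with s hs
      have hmap : q.map (MvPolynomial.eval s) ≠ 0 := by
        intro h0
        apply hs
        have := congrArg (fun r => Polynomial.coeff r q.natDegree) h0
        simpa [Polynomial.coeff_map] using this
      -- a nonzero polynomial in one variable has finitely many roots, and these are null
      refine measure_mono_null ?_ ((Polynomial.rootSet_finite
        (q.map (MvPolynomial.eval s)) ℂ).measure_zero (ν 0))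
      intro y hy
      rw [Polynomial.mem_rootSet]
      refine ⟨hmap, ?_⟩
      have hy' : MvPolynomial.eval (Fin.cons y s : Fin (n + 1) → ℂ) p = 0 := by
        simpa [MeasurableEquiv.piFinSuccAbove, Fin.insertNthEquiv] using hy
      rw [MvPolynomial.eval_eq_eval_mv_eval'] at hy'
      simpa using hy'
    · exact (measurable_measure_prodMk_right (hmp.measurable hmeas)).aemeasurable

/-- A nonzero polynomial vanishes only on a null set of a product of atomless measures. -/
theorem ae_eval_ne_zero {ι : Type*} [Fintype ι] (ν : ι → Measure ℂ) [∀ j, SigmaFinite (ν j)]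
    [∀ j, NullSingletonClass (ν j)] (p : MvPolynomial ι ℂ) (hp : p ≠ 0) :
    ∀ᵐ x ∂(Measure.pi ν), MvPolynomial.eval x p ≠ 0 := by
  let e := (Fintype.equivFin ι).symm
  have hp' : MvPolynomial.rename e.symm p ≠ 0 :=
    (map_ne_zero_iff _ (MvPolynomial.rename_injective _ e.symm.injective)).2 hp
  have h := ae_eval_ne_zero_fin (fun j => ν (e j)) _ hp'
  have hmp := measurePreserving_piCongrLeft ν e
  have hset : MeasurableSet {x | MvPolynomial.eval x p ≠ 0} :=
    ((isClosed_singleton.preimage (MvPolynomial.continuous_eval p)).measurableSet).compl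
  rw [← hmp.map_eq, ae_map_iff hmp.measurable.aemeasurable hset]
  filter_upwards [h] with x hx
  rw [MvPolynomial.eval_rename] at hx
  convert hx using 3
  funext i
  obtain ⟨j, rfl⟩ := e.surjective i
  simp [MeasurableEquiv.piCongrLeft_apply_apply]

/-- The generalized alternant: the determinant of the matrix whose entry `(a, b)` is the `b`-th
monomial in the `a`-th block of variables is a nonzero polynomial if the monomials are distinct,
since the diagonal product occurs in its expansion only once. -/
theorem det_monomial_ne_zero {ι κ : Type*} [Fintype ι] [DecidableEq ι]
    (ex : ι → κ →₀ ℕ) (hex : Function.Injective ex) :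
    (Matrix.of fun a b : ι => MvPolynomial.rename (fun j : κ => (j, a))
      (MvPolynomial.monomial (ex b) (1 : ℂ))).det ≠ 0 := by
  classical
  have hterm : ∀ σ : Equiv.Perm ι, (∏ a, (Matrix.of fun a b : ι =>
      MvPolynomial.rename (fun j : κ => (j, a)) (MvPolynomial.monomial (ex b) (1 : ℂ))) (σ a) a) =
      MvPolynomial.monomial (∑ a, (ex a).mapDomain (fun j : κ => (j, σ a))) 1 := by
    intro σ
    rw [MvPolynomial.monomial_sum_one]
    simp [MvPolynomial.rename_monomial]
  intro h0
  have hc := congrArg (MvPolynomial.coeff (∑ a, (ex a).mapDomain (fun j : κ => (j, a)))) h0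
  rw [Matrix.det_apply, MvPolynomial.coeff_sum, Finset.sum_eq_single 1] at hc
  · rw [hterm] at hc
    simp at hc
  · intro σ _ hσ
    rw [hterm]
    simp only [MvPolynomial.coeff_smul, MvPolynomial.coeff_monomial]
    rw [if_neg, smul_zero]
    intro he
    apply hσ
    ext b
    have key : ∀ τ : Equiv.Perm ι, ∀ (b : ι) (j : κ),
        (∑ a, (ex a).mapDomain (fun j : κ => (j, τ a))) (j, τ b) = ex b j := by
      intro τ b j
      rw [Finsupp.finsetSum_apply, Finset.sum_eq_single b]
      · exact Finsupp.mapDomain_apply (fun x y hxy => (Prod.ext_iff.1 hxy).1) _ _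
      · intro a _ hab
        apply Finsupp.mapDomain_of_notMem_range
        rintro ⟨y, hy⟩
        exact hab (τ.injective (Prod.ext_iff.1 hy).2)
      · simp
    have h1 : ex b = ex (σ b) := by
      ext j
      rw [← key σ b j, he]
      simpa using key 1 (σ b) j
    simpa using (hex h1).symm
  · simp

/-! ### Interference alignment -/

/-- Perfect interference alignment over `F` slots. Every transmitter sends along the beams `v α`.
The cross channel from `k` to `i` carries the beam `v α` to one of the beams `v' β`, namely
`β = σ i k α`, so all interference at a receiver lies in the span of the `v' β`; and the linear map
`A i` recovers at receiver `i` the coefficients along the desired beams `h i i * v α` and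
annihilates the interference. -/
def HasAlignment {K : ℕ} (h : Channel K) (D E : Type) [DecidableEq D] (F : ℕ) : Prop :=
  ∃ (v : D → Fin F → ℂ) (v' : E → Fin F → ℂ) (σ : Fin K → Fin K → D → E)
    (A : Fin K → D → Fin F → ℂ),
    (∀ i k, Function.Injective (σ i k)) ∧
    (∀ i k, i ≠ k → ∀ (α : D) (f : Fin F), h i k f * v α f = v' (σ i k α) f) ∧
    (∀ i α α', ∑ f, A i α f * (h i i f * v α' f) = if α = α' then 1 else 0) ∧
    (∀ i α β, ∑ f, A i α f * v' β f = 0)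

/-- The ordered pairs of distinct users, which index the cross channels. -/
abbrev CrossPair (K : ℕ) : Type := {p : Fin K × Fin K // p.1 ≠ p.2}

/-- Exponents of the cross gains, as exponents of all gains. -/
def crossExponent {K m : ℕ} (β : CrossPair K → Fin m) : Fin K × Fin K →₀ ℕ :=
  Finsupp.equivFunOnFinite.symm fun p => if hp : p.1 ≠ p.2 then (β ⟨p, hp⟩ : ℕ) else 0

theorem crossExponent_diag {K m : ℕ} (β : CrossPair K → Fin m) (i : Fin K) :
    crossExponent β (i, i) = 0 := by
  simp [crossExponent]

theorem crossExponent_injective {K m : ℕ} :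
    Function.Injective (crossExponent : (CrossPair K → Fin m) → _) := by
  intro β β' hb
  funext p
  have := DFunLike.congr_fun hb p.1
  simp only [crossExponent, Finsupp.equivFunOnFinite_symm_apply_apply, dif_pos p.2] at this
  exact Fin.ext this

/-- The exponents of the beams seen by receiver `i`: the desired beams carry one factor `h i i`. -/
def beamExponent {K m : ℕ} (i : Fin K) :
    (CrossPair K → Fin m) ⊕ (CrossPair K → Fin (m + 1)) → (Fin K × Fin K →₀ ℕ) :=
  Sum.elim (fun α => Finsupp.single (i, i) 1 + crossExponent α) crossExponent

theorem beamExponent_injective {K m : ℕ} (i : Fin K) :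
    Function.Injective (beamExponent (m := m) i) := by
  rintro (a | a) (b | b) hab
  · simp only [beamExponent, Sum.elim_inl, add_right_inj] at hab
    rw [crossExponent_injective hab]
  · have := DFunLike.congr_fun hab (i, i)
    simp [beamExponent, crossExponent_diag] at this
  · have := DFunLike.congr_fun hab (i, i)
    simp [beamExponent, crossExponent_diag] at this
  · simp only [beamExponent, Sum.elim_inr] at hab
    rw [crossExponent_injective hab]

theorem prod_pow_crossExponent {K m : ℕ} (β : CrossPair K → Fin m) (x : Fin K × Fin K → ℂ) :
    ∏ p, x p ^ crossExponent β p = ∏ p : CrossPair K, x p.1 ^ (β p : ℕ) := by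
  rw [← Fintype.prod_subtype_mul_prod_subtype (fun p : Fin K × Fin K => p.1 ≠ p.2)]
  have h2 : ∀ p : {p : Fin K × Fin K // ¬ (p.1 ≠ p.2)}, x p.1 ^ crossExponent β p.1 = 1 := by
    intro p
    have := p.2
    simp [crossExponent, not_not.1 this]
  rw [Finset.prod_congr rfl (fun p _ => h2 p), Finset.prod_const_one, mul_one]
  refine Finset.prod_congr rfl fun p _ => ?_
  simp [crossExponent, p.2]

/-- The exponent of a beam after passing the cross channel from `k` to `i`; the value for `k = i`
is a convention. -/
def shiftExponent {K m : ℕ} (i k : Fin K) (α : CrossPair K → Fin m) (p : CrossPair K) :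
    Fin (m + 1) :=
  if p.1 = (i, k) then (α p).succ else (α p).castSucc

theorem shiftExponent_injective {K m : ℕ} (i k : Fin K) :
    Function.Injective (shiftExponent (m := m) i k) := by
  intro α α' ha
  funext p
  have := congrFun ha p
  unfold shiftExponent at this
  split_ifs at this
  · exact Fin.succ_injective _ this
  · exact Fin.castSucc_injective _ this

theorem prod_pow_shiftExponent {K m : ℕ} {i k : Fin K} (hik : i ≠ k) (α : CrossPair K → Fin m)
    (x : Fin K × Fin K → ℂ) :
    ∏ p : CrossPair K, x p.1 ^ (shiftExponent i k α p : ℕ) =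
      x (i, k) * ∏ p : CrossPair K, x p.1 ^ (α p : ℕ) := by
  have h1 : ∀ p : CrossPair K, x p.1 ^ (shiftExponent i k α p : ℕ) =
      (if p = ⟨(i, k), hik⟩ then x (i, k) else 1) * x p.1 ^ (α p : ℕ) := by
    intro p
    unfold shiftExponent
    by_cases hp : p.1 = (i, k)
    · have hp' : p = ⟨(i, k), hik⟩ := Subtype.ext hp
      rw [if_pos hp, if_pos hp', hp, Fin.val_succ, pow_succ, mul_comm]
    · have hp' : ¬ p = ⟨(i, k), hik⟩ := fun h => hp (congrArg Subtype.val h)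
      rw [if_neg hp, if_neg hp', one_mul, Fin.val_castSucc]
  rw [Finset.prod_congr rfl (fun p _ => h1 p), Finset.prod_mul_distrib]
  simp

/-- The matrix of the beams seen by receiver `i`, desired beams first: the rows are the slots
(numbered by the index set of the beams), and the entries are polynomials in the gains. -/
def beamMatrix {K : ℕ} (m : ℕ) (i : Fin K) :
    Matrix ((CrossPair K → Fin m) ⊕ (CrossPair K → Fin (m + 1)))
      ((CrossPair K → Fin m) ⊕ (CrossPair K → Fin (m + 1)))
      (MvPolynomial ((Fin K × Fin K) × ((CrossPair K → Fin m) ⊕ (CrossPair K → Fin (m + 1)))) ℂ) :=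
  Matrix.of fun a b => MvPolynomial.rename (fun j => (j, a))
    (MvPolynomial.monomial (beamExponent i b) (1 : ℂ))

/-- The rows of the inverse beam matrices that belong to desired beams are the zero forcing maps. -/
theorem hasAlignment_of_det_ne_zero {K : ℕ} (h : Channel K) (m F : ℕ)
    (e : (CrossPair K → Fin m) ⊕ (CrossPair K → Fin (m + 1)) ≃ Fin F)
    (hdet : ∀ i, MvPolynomial.eval (fun j => h j.1.1 j.1.2 (e j.2)) (beamMatrix m i).det ≠ 0) :
    HasAlignment h (CrossPair K → Fin m) (CrossPair K → Fin (m + 1)) F := by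
  let G : Fin K → Matrix ((CrossPair K → Fin m) ⊕ (CrossPair K → Fin (m + 1)))
      ((CrossPair K → Fin m) ⊕ (CrossPair K → Fin (m + 1))) ℂ := fun i =>
    (MvPolynomial.eval (fun j => h j.1.1 j.1.2 (e j.2))).mapMatrix (beamMatrix m i)
  have hG : ∀ i, (G i)⁻¹ * G i = 1 := by
    intro i
    refine Matrix.nonsing_inv_mul _ ?_
    rw [isUnit_iff_ne_zero]
    have := hdet i
    rwa [RingHom.map_det] at this
  have hGe : ∀ i a b, G i a b = ∏ p, h p.1 p.2 (e a) ^ beamExponent i b p := by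
    intro i a b
    simp [G, beamMatrix, MvPolynomial.eval_rename, MvPolynomial.eval_monomial,
      Finsupp.prod_fintype]
  refine ⟨fun α f => ∏ p : CrossPair K, h p.1.1 p.1.2 f ^ (α p : ℕ),
    fun β f => ∏ p : CrossPair K, h p.1.1 p.1.2 f ^ (β p : ℕ), shiftExponent,
    fun i α f => (G i)⁻¹ (Sum.inl α) (e.symm f), shiftExponent_injective, ?_, ?_, ?_⟩
  · intro i k hik α f
    exact (prod_pow_shiftExponent hik α (fun p => h p.1 p.2 f)).symm
  · intro i α α'
    have h1 := congrFun (congrFun (hG i) (Sum.inl α)) (Sum.inl α')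
    rw [Matrix.mul_apply, Matrix.one_apply] at h1
    simp only [Sum.inl.injEq] at h1
    rw [← h1, ← e.sum_comp]
    refine Finset.sum_congr rfl fun a _ => ?_
    simp only [e.symm_apply_apply, hGe]
    congr 1
    simp only [beamExponent, Sum.elim_inl, Finsupp.add_apply, pow_add, Finset.prod_mul_distrib,
      ← prod_pow_crossExponent α' (fun p => h p.1 p.2 (e a))]
    congr 1
    rw [Finset.prod_eq_single (i, i)]
    · simp
    · intro p _ hp
      rw [Finsupp.single_eq_of_ne hp, pow_zero]
    · simp
  · intro i α β
    have h1 := congrFun (congrFun (hG i) (Sum.inl α)) (Sum.inr β)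
    rw [Matrix.mul_apply, Matrix.one_apply] at h1
    simp only [reduceCtorEq, if_false] at h1
    rw [← h1, ← e.sum_comp]
    refine Finset.sum_congr rfl fun a _ => ?_
    simp only [e.symm_apply_apply, hGe]
    simp only [beamExponent, Sum.elim_inr,
      ← prod_pow_crossExponent β (fun p => h p.1 p.2 (e a))]

/-- For continuously distributed gains, alignment with `m` powers of each cross gain is possible
almost surely. -/
theorem ae_hasAlignment {Ω : Type*} [MeasurableSpace Ω] (P : Measure Ω) {K : ℕ}
    (h : Fin K → Fin K → ℕ → Ω → ℂ) (hmeas : ∀ i k f, Measurable (h i k f))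
    (hcont : ContinuouslyDistributed P h) (m : ℕ) :
    ∀ᵐ ω ∂P, HasAlignment (fun i k f => h i k f ω) (CrossPair K → Fin m)
      (CrossPair K → Fin (m + 1))
      (Fintype.card ((CrossPair K → Fin m) ⊕ (CrossPair K → Fin (m + 1)))) := by
  set F := Fintype.card ((CrossPair K → Fin m) ⊕ (CrossPair K → Fin (m + 1))) with hF
  let e : (CrossPair K → Fin m) ⊕ (CrossPair K → Fin (m + 1)) ≃ Fin F := Fintype.equivFin _
  obtain ⟨ν, hν1, hν2, hac⟩ := hcont F
  have hι : Function.Injective (fun j : (Fin K × Fin K) ×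
      ((CrossPair K → Fin m) ⊕ (CrossPair K → Fin (m + 1))) => (j.1.1, j.1.2, e j.2)) := by
    rintro ⟨⟨a, b⟩, c⟩ ⟨⟨a', b'⟩, c'⟩ hj
    simp only [Prod.mk.injEq, EmbeddingLike.apply_eq_iff_eq] at hj
    simp [hj.1, hj.2.1, hj.2.2]
  have key : ∀ i, ∀ᵐ ω ∂P, MvPolynomial.eval (fun j : (Fin K × Fin K) ×
      ((CrossPair K → Fin m) ⊕ (CrossPair K → Fin (m + 1))) => h j.1.1 j.1.2 (e j.2) ω)
      (beamMatrix m i).det ≠ 0 := by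
    intro i
    have h0 := det_monomial_ne_zero (beamExponent (m := m) i) (beamExponent_injective i)
    have h1 := ae_eval_ne_zero ν _
      ((map_ne_zero_iff _ (MvPolynomial.rename_injective _ hι)).2 h0)
    have h2 := ae_of_ae_map (f := fun ω (j : Fin K × Fin K × Fin F) => h j.1 j.2.1 j.2.2 ω)
      (by fun_prop) (hac.ae_le h1)
    filter_upwards [h2] with ω hω
    rw [MvPolynomial.eval_rename] at hω
    exact hω
  filter_upwards [ae_all_iff.2 key] with ω hω
  exact hasAlignment_of_det_ne_zero _ m F e hω

/-! ### Block codes with large Hamming distance -/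

theorem card_hammingBall_le {n : ℕ} {β : Type*} [Fintype β] [DecidableEq β] [Nonempty β]
    (x : Fin n → β) (r : ℕ) :
    (Finset.univ.filter fun y => hammingDist x y ≤ r).card ≤ 2 ^ n * Fintype.card β ^ r := by
  classical
  have hsub : (Finset.univ.filter fun y => hammingDist x y ≤ r) ⊆
      (Finset.univ.filter fun T : Finset (Fin n) => T.card ≤ r).biUnion fun T =>
        Finset.univ.filter fun y => ∀ t, t ∉ T → x t = y t := by
    intro y hy
    rw [Finset.mem_filter] at hy
    simp only [Finset.mem_biUnion, Finset.mem_filter, Finset.mem_univ, true_and]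
    refine ⟨Finset.univ.filter fun t => x t ≠ y t, hy.2, ?_⟩
    intro t ht
    simpa using ht
  refine (Finset.card_le_card hsub).trans ?_
  refine (Finset.card_biUnion_le_card_mul _ _ (Fintype.card β ^ r) ?_).trans ?_
  · intro T hT
    rw [Finset.mem_filter] at hT
    calc _ ≤ (Finset.univ : Finset (T → β)).card := by
          refine Finset.card_le_card_of_injOn (fun y t => y t)
            (fun _ _ => Finset.mem_coe.2 (Finset.mem_univ _)) ?_
          intro y hy y' hy' hyy
          simp only [Finset.coe_filter, Finset.mem_univ, true_and, Set.mem_ofPred_eq] at hy hy'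
          funext t
          by_cases ht : t ∈ T
          · exact congrFun hyy ⟨t, ht⟩
          · rw [← hy t ht, hy' t ht]
      _ = Fintype.card β ^ T.card := by simp
      _ ≤ Fintype.card β ^ r := Nat.pow_le_pow_right Fintype.card_pos hT.2
  · refine Nat.mul_le_mul_right _ ((Finset.card_le_univ _).trans ?_)
    simp

/-- The Gilbert–Varshamov bound, with a crude estimate for the size of a Hamming ball. -/
theorem exists_code {n : ℕ} {U β : Type*} [Fintype U] [Fintype β] [DecidableEq β] [Nonempty β]
    (r : ℕ) (hcard : Fintype.card U * (2 ^ n * Fintype.card β ^ r) ≤ Fintype.card β ^ n) :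
    ∃ c : U → Fin n → β, ∀ u u', u ≠ u' → r < hammingDist (c u) (c u') := by
  classical
  have key : ∀ k : ℕ, k ≤ Fintype.card U → ∃ C : Finset (Fin n → β), C.card = k ∧
      ∀ x ∈ C, ∀ y ∈ C, x ≠ y → r < hammingDist x y := by
    intro k
    induction k with
    | zero => exact fun _ => ⟨∅, rfl, by simp⟩
    | succ k ih =>
      intro hk
      obtain ⟨C, hC, hd⟩ := ih (by omega)
      -- the balls around the `k` codewords chosen so far do not cover the whole space
      have hlt : (C.biUnion fun x => Finset.univ.filter fun y => hammingDist x y ≤ r).card <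
          (Finset.univ : Finset (Fin n → β)).card := by
        refine (Finset.card_biUnion_le_card_mul _ _ _
          fun x _ => card_hammingBall_le x r).trans_lt ?_
        rw [hC]
        have hV : 0 < 2 ^ n * Fintype.card β ^ r := by
          have : 0 < Fintype.card β := Fintype.card_pos
          positivity
        calc k * (2 ^ n * Fintype.card β ^ r) < (k + 1) * (2 ^ n * Fintype.card β ^ r) :=
              Nat.mul_lt_mul_of_pos_right (Nat.lt_succ_self k) hV
          _ ≤ Fintype.card U * (2 ^ n * Fintype.card β ^ r) := Nat.mul_le_mul_right _ hk
          _ ≤ Fintype.card β ^ n := hcard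
          _ = _ := by simp
      obtain ⟨y, -, hy⟩ := Finset.exists_mem_notMem_of_card_lt_card hlt
      simp only [Finset.mem_biUnion, Finset.mem_filter, Finset.mem_univ, true_and, not_exists,
        not_and, not_le] at hy
      have hyC : y ∉ C := by
        intro hyC
        simpa using hy y hyC
      refine ⟨insert y C, by rw [Finset.card_insert_of_notMem hyC, hC], ?_⟩
      intro a ha b hb hab
      rw [Finset.mem_insert] at ha hb
      rcases ha with rfl | ha <;> rcases hb with rfl | hb
      · exact absurd rfl hab
      · rw [hammingDist_comm]; exact hy b hb
      · exact hy a ha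
      · exact hd a ha b hb hab
  obtain ⟨C, hC, hd⟩ := key _ le_rfl
  have e : U ≃ C := Fintype.equivOfCardEq (by simp [hC])
  refine ⟨fun u => (e u).1, fun u u' hu => hd _ (e u).2 _ (e u').2 ?_⟩
  intro h
  exact hu (e.injective (Subtype.ext h))

/-- Unique decoding within half the minimum distance. -/
theorem exists_decoder {n : ℕ} {U β : Type*} [Nonempty U] [DecidableEq β] {r : ℕ}
    (c : U → Fin n → β) (hc : ∀ u u', u ≠ u' → r < hammingDist (c u) (c u')) :
    ∃ dec : (Fin n → β) → U, ∀ u y, 2 * hammingDist (c u) y ≤ r → dec y = u := by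
  classical
  refine ⟨fun y => if hy : ∃ u, 2 * hammingDist (c u) y ≤ r then hy.choose
    else Classical.arbitrary U, fun u y hu => ?_⟩
  have hy : ∃ u, 2 * hammingDist (c u) y ≤ r := ⟨u, hu⟩
  simp only [dif_pos hy]
  by_contra hne
  have h1 := hc _ _ hne
  have h2 := hammingDist_triangle_right (c hy.choose) (c u) y
  have h3 := hy.choose_spec
  omega

/-- More than `r` out of `n` independent events of the same probability occur simultaneously with
probability at most `2 ^ n` times the `(r + 1)`-st power of that probability. -/
theorem measure_pi_card_lt_le {n : ℕ} {X : Type*} [MeasurableSpace X] (μ : Measure X)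
    [IsProbabilityMeasure μ] (E : Set X) [DecidablePred (· ∈ E)] (r : ℕ) :
    Measure.pi (fun _ : Fin n => μ) {z | r < (Finset.univ.filter fun t => z t ∈ E).card} ≤
      2 ^ n * μ E ^ (r + 1) := by
  have hsub : {z : Fin n → X | r < (Finset.univ.filter fun t => z t ∈ E).card} ⊆
      ⋃ T ∈ (Finset.univ : Finset (Fin n)).powersetCard (r + 1),
        (T : Set (Fin n)).pi fun _ => E := by
    intro z hz
    obtain ⟨T, hT, hTc⟩ := Finset.exists_subset_card_eq (Nat.succ_le_of_lt hz)
    simp only [Set.mem_iUnion, Finset.mem_powersetCard]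
    refine ⟨T, ⟨Finset.subset_univ _, hTc⟩, fun t ht => ?_⟩
    simpa using hT ht
  refine (measure_mono hsub).trans ((measure_biUnion_finset_le _ _).trans ?_)
  calc ∑ T ∈ (Finset.univ : Finset (Fin n)).powersetCard (r + 1),
        Measure.pi (fun _ : Fin n => μ) ((T : Set (Fin n)).pi fun _ => E)
      = ∑ T ∈ (Finset.univ : Finset (Fin n)).powersetCard (r + 1), μ E ^ (r + 1) := by
        refine Finset.sum_congr rfl fun T hT => ?_
        rw [Measure.pi_pi_finset, Finset.prod_const, (Finset.mem_powersetCard.1 hT).2]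
    _ = (n.choose (r + 1) : ENNReal) * μ E ^ (r + 1) := by simp
    _ ≤ 2 ^ n * μ E ^ (r + 1) := by
        gcongr
        exact_mod_cast Nat.choose_le_two_pow n (r + 1)

/-! ### Random binning and leakage through a deterministic observation -/

section Binning

set_option linter.unusedSectionVars false

variable {A B : Type*} [Fintype A] [Fintype B] [DecidableEq A] [DecidableEq B]

/-- The indicator that the permutation `π` puts the codeword index `u` into the bin `w`. -/
def hit (π : Equiv.Perm (A × B)) (w : A) (u : A × B) : ℝ :=
  if (π.symm u).1 = w then 1 else 0

theorem sum_hit (π : Equiv.Perm (A × B)) (w : A) : ∑ u, hit π w u = Fintype.card B := by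
  rw [← Equiv.sum_comp π, Fintype.sum_prod_type_right]
  simp [hit]

theorem hit_mul_self (π : Equiv.Perm (A × B)) (w : A) (u : A × B) :
    hit π w u * hit π w u = hit π w u := by
  unfold hit; split_ifs <;> simp

theorem hit_mul_perm (τ π : Equiv.Perm (A × B)) (w : A) (u : A × B) :
    hit (τ * π) w (τ u) = hit π w u := by
  have h : (τ * π).symm (τ u) = π.symm u := by
    rw [Equiv.symm_apply_eq, Equiv.Perm.mul_apply, Equiv.apply_symm_apply]
  rw [hit, hit, h]

/-- Under a uniform permutation, an index lies in a given bin with probability `1 / |A|`. -/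
theorem sum_perm_hit [Nonempty B] (w : A) (u : A × B) :
    ∑ π : Equiv.Perm (A × B), hit π w u =
      Fintype.card (Equiv.Perm (A × B)) * (Fintype.card A : ℝ)⁻¹ := by
  have hsym : ∀ u', ∑ π : Equiv.Perm (A × B), hit π w u' =
      ∑ π : Equiv.Perm (A × B), hit π w u := by
    intro u'
    rw [← Equiv.sum_comp (Equiv.mulLeft (Equiv.swap u u'))]
    refine Finset.sum_congr rfl fun π _ => ?_
    have := hit_mul_perm (Equiv.swap u u') π w u
    rwa [Equiv.swap_apply_left] at this
  have h1 : ∑ u', ∑ π : Equiv.Perm (A × B), hit π w u' =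
      Fintype.card (Equiv.Perm (A × B)) * (Fintype.card B : ℝ) := by
    rw [Finset.sum_comm]
    simp [sum_hit]
  rw [Finset.sum_congr rfl (fun u' _ => hsym u'), Finset.sum_const, Finset.card_univ,
    Fintype.card_prod, nsmul_eq_mul] at h1
  have hA : (Fintype.card A : ℝ) ≠ 0 := by
    have : Nonempty A := ⟨w⟩
    exact_mod_cast Fintype.card_ne_zero
  have hB : (Fintype.card B : ℝ) ≠ 0 := by exact_mod_cast Fintype.card_ne_zero
  push_cast at h1
  field_simp
  apply mul_right_cancel₀ hB
  linarith

/-- Under a uniform permutation, two distinct indices lie in a given bin with probability at most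
`1 / |A| ^ 2`: the bins are filled without replacement. -/
theorem sum_perm_hit_mul_hit_le [Nonempty B] (w : A) {u u' : A × B} (huu : u ≠ u') :
    ∑ π : Equiv.Perm (A × B), hit π w u * hit π w u' ≤
      Fintype.card (Equiv.Perm (A × B)) * ((Fintype.card A : ℝ)⁻¹ * (Fintype.card A : ℝ)⁻¹) := by
  set c := ∑ π : Equiv.Perm (A × B), hit π w u * hit π w u' with hc
  -- the permutation group is doubly transitive, so the sum does not depend on the pair
  have hsym : ∀ v v', v ≠ v' → ∑ π : Equiv.Perm (A × B), hit π w v * hit π w v' = c := by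
    intro v v' hv
    set x := Equiv.swap u v u' with hx
    have hxv : x ≠ v := by
      intro h
      have h2 : Equiv.swap u v u' = Equiv.swap u v u := by rw [← hx, h, Equiv.swap_apply_left]
      exact huu ((Equiv.swap u v).injective h2).symm
    let τ := Equiv.swap x v' * Equiv.swap u v
    have h1 : τ u = v := by
      simp only [τ, Equiv.Perm.mul_apply, Equiv.swap_apply_left]
      exact Equiv.swap_apply_of_ne_of_ne hxv.symm hv
    have h2 : τ u' = v' := by
      simp only [τ, Equiv.Perm.mul_apply]
      rw [← hx, Equiv.swap_apply_left]
    rw [hc, ← Equiv.sum_comp (Equiv.mulLeft τ)]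
    refine Finset.sum_congr rfl fun π _ => ?_
    simp only [Equiv.coe_mulLeft]
    rw [← h1, ← h2, hit_mul_perm, hit_mul_perm]
  set p : ℝ := (Fintype.card (Equiv.Perm (A × B)) : ℝ) with hp
  set N : ℝ := (Fintype.card (A × B) : ℝ) with hN
  set b : ℝ := (Fintype.card B : ℝ) with hb
  set a : ℝ := (Fintype.card A : ℝ) with ha
  have hNab : N = a * b := by rw [hN, Fintype.card_prod]; push_cast; rfl
  -- sum over all pairs in two ways
  have hall : ∑ v, ∑ v', ∑ π : Equiv.Perm (A × B), hit π w v * hit π w v' = p * (b * b) := by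
    have : ∀ v, ∑ v', ∑ π : Equiv.Perm (A × B), hit π w v * hit π w v' =
        ∑ π : Equiv.Perm (A × B), hit π w v * b := by
      intro v
      rw [Finset.sum_comm]
      refine Finset.sum_congr rfl fun π _ => ?_
      rw [← Finset.mul_sum, sum_hit]
    rw [Finset.sum_congr rfl (fun v _ => this v), Finset.sum_comm]
    simp_rw [← Finset.sum_mul, sum_hit]
    simp [p, b, mul_assoc]
  have hdiag : ∀ v, ∑ v', ∑ π : Equiv.Perm (A × B), hit π w v * hit π w v' =
      p * a⁻¹ + (N - 1) * c := by
    intro v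
    rw [← Finset.add_sum_erase _ _ (Finset.mem_univ v)]
    congr 1
    · simp_rw [hit_mul_self]
      rw [sum_perm_hit]
    · rw [Finset.sum_congr rfl (fun v' hv' => hsym v v' (Finset.ne_of_mem_erase hv').symm),
        Finset.sum_const, Finset.card_erase_of_mem (Finset.mem_univ v), Finset.card_univ,
        nsmul_eq_mul, Nat.cast_sub (Fintype.card_pos_iff.2 ⟨v⟩)]
      simp [N]
  rw [Finset.sum_congr rfl (fun v _ => hdiag v), Finset.sum_const, Finset.card_univ,
    nsmul_eq_mul, ← hN] at hall
  have hA : 1 ≤ a := by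
    have : Nonempty A := ⟨w⟩
    have := Fintype.card_pos (α := A)
    rw [ha]; exact_mod_cast this
  have hB : 1 ≤ b := by
    have := Fintype.card_pos (α := B)
    rw [hb]; exact_mod_cast this
  have hN1 : 1 < N := by
    have : Nontrivial (A × B) := ⟨u, u', huu⟩
    rw [hN]; exact_mod_cast Fintype.one_lt_card
  have hp0 : 0 ≤ p := by positivity
  have hpa : p * a⁻¹ * N = p * b := by rw [hNab]; field_simp
  have hcN : N * (N - 1) * c = p * b * (b - 1) := by linear_combination hall - hpa
  have hmul : N * (N - 1) * c ≤ N * (N - 1) * (p * (a⁻¹ * a⁻¹)) := by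
    rw [hcN, hNab]
    have h3 : a * b * (a * b - 1) * (p * (a⁻¹ * a⁻¹)) = p * b * (b - a⁻¹) := by
      field_simp
    rw [h3]
    have : a⁻¹ ≤ 1 := inv_le_one_of_one_le₀ hA
    have hpb : 0 ≤ p * b := by positivity
    nlinarith
  exact le_of_mul_le_mul_left hmul (by nlinarith)

variable {J Z : Type*} [Fintype J] [DecidableEq J] [Fintype Z] [DecidableEq Z]

/-- The law of the observation `g` of the codeword indices, given the bins `w`. -/
def binLaw (g : (J → A × B) → Z) (π : J → Equiv.Perm (A × B)) (w : J → A) (z : Z) : ℝ :=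
  ((Finset.univ.filter fun r : J → B => g (fun j => π j (w j, r j)) = z).card : ℝ) /
    (Fintype.card B : ℝ) ^ Fintype.card J

/-- The law of the observation `g` of independent uniform codeword indices. -/
def uniformLaw (g : (J → A × B) → Z) (z : Z) : ℝ :=
  ((Finset.univ.filter fun u : J → A × B => g u = z).card : ℝ) /
    (Fintype.card (A × B) : ℝ) ^ Fintype.card J

/-- The `L¹` distance between the law of the observation given the bins `w` and its law for uniform
indices. -/
def leakage (g : (J → A × B) → Z) (π : J → Equiv.Perm (A × B)) (w : J → A) : ℝ :=
  ∑ z, |binLaw g π w z - uniformLaw g z|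

/-- A sum over the randomization indices is a sum over all codeword indices in the bins `w`. -/
theorem sum_bin_eq (f : (J → A × B) → ℝ) (π : J → Equiv.Perm (A × B)) (w : J → A) :
    ∑ r : J → B, f (fun j => π j (w j, r j)) = ∑ u, f u * ∏ j, hit (π j) (w j) (u j) := by
  rw [← (Equiv.piCongrRight π).sum_comp,
    ← (Equiv.arrowProdEquivProdArrow J (fun _ => A) (fun _ => B)).symm.sum_comp,
    Fintype.sum_prod_type, Finset.sum_eq_single w]
  · refine Finset.sum_congr rfl fun r _ => ?_
    simp only [hit, Equiv.arrowProdEquivProdArrow, Equiv.piCongrRight, Equiv.coe_fn_mk,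
      Equiv.coe_fn_symm_mk, Pi.map, Equiv.symm_apply_apply, if_true, Finset.prod_const_one, mul_one]
    rfl
  · intro a _ haw
    refine Finset.sum_eq_zero fun r _ => ?_
    obtain ⟨j, hj⟩ := Function.ne_iff.1 haw
    rw [Finset.prod_eq_zero (Finset.mem_univ j), mul_zero]
    simp [hit, Equiv.arrowProdEquivProdArrow, Equiv.piCongrRight, Pi.map, hj]
  · simp

/-- The pairs of index tuples that differ exactly on `T ≠ ∅` and give the same observation: the
second tuple is determined by its entries on `T` without one place. -/
theorem card_same_observation_le (g : (J → A × B) → Z)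
    (hg : ∀ u j, Function.Injective fun x => g (Function.update u j x)) (u : J → A × B)
    (T : Finset J) (hT : T.Nonempty) :
    (Finset.univ.filter fun u' => g u' = g u ∧ (Finset.univ.filter fun j => u j ≠ u' j) = T).card ≤
      Fintype.card (A × B) ^ (T.card - 1) := by
  obtain ⟨j0, hj0⟩ := hT
  calc _ ≤ (Finset.univ : Finset (↥(T.erase j0) → A × B)).card := by
        refine Finset.card_le_card_of_injOn (fun u' j => u' j)
          (fun _ _ => Finset.mem_coe.2 (Finset.mem_univ _)) ?_
        intro x hx y hy hxy
        simp only [Finset.coe_filter, Finset.mem_univ, true_and, Set.mem_ofPred_eq] at hx hy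
        have hagree : ∀ j, j ≠ j0 → x j = y j := by
          intro j hj
          by_cases hjT : j ∈ T
          · exact congrFun hxy ⟨j, Finset.mem_erase.2 ⟨hj, hjT⟩⟩
          · have h1 : u j = x j := by
              by_contra h
              exact hjT (hx.2 ▸ by simpa using h)
            have h2 : u j = y j := by
              by_contra h
              exact hjT (hy.2 ▸ by simpa using h)
            rw [← h1, h2]
        have hup : Function.update x j0 (y j0) = y := by
          funext j
          by_cases hj : j = j0
          · subst hj; simp
          · rw [Function.update_of_ne hj, hagree j hj]
        have := @hg x j0 (x j0) (y j0) (by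
          simp only [Function.update_eq_self, hup]; rw [hx.1, hy.1])
        rw [← hup, ← this, Function.update_eq_self]
    _ = _ := by
        rw [Finset.card_univ, Fintype.card_fun, Fintype.card_coe, Finset.card_erase_of_mem hj0]

/-- The probability bound for two indices in a common bin. -/
def pairWeight (x y : A × B) : ℝ :=
  if x = y then (Fintype.card A : ℝ)⁻¹ else (Fintype.card A : ℝ)⁻¹ * (Fintype.card A : ℝ)⁻¹

theorem prod_pairWeight (u u' : J → A × B) :
    ∏ j, pairWeight (u j) (u' j) = ((Fintype.card A : ℝ)⁻¹) ^ Fintype.card J *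
      ((Fintype.card A : ℝ)⁻¹) ^ (Finset.univ.filter fun j => u j ≠ u' j).card := by
  have h : ∀ x y : A × B, pairWeight x y =
      (Fintype.card A : ℝ)⁻¹ * (if x ≠ y then (Fintype.card A : ℝ)⁻¹ else 1) := by
    intro x y
    unfold pairWeight
    by_cases hxy : x = y <;> simp [hxy]
  simp_rw [h]
  rw [Finset.prod_mul_distrib, Finset.prod_const, Finset.card_univ, Finset.prod_ite]
  simp

/-- Index tuples that differ in all places do not contribute to the variance, and few of the other
tuples give the same observation. -/
theorem sum_pairWeight_sub_le [Nonempty A] [Nonempty B] (g : (J → A × B) → Z)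
    (hg : ∀ u j, Function.Injective fun x => g (Function.update u j x)) (u : J → A × B) :
    ∑ u' ∈ Finset.univ.filter (fun u' => g u' = g u),
      (∏ j, pairWeight (u j) (u' j) - ((Fintype.card A : ℝ)⁻¹) ^ Fintype.card J *
        ((Fintype.card A : ℝ)⁻¹) ^ Fintype.card J) ≤
      ((Fintype.card A : ℝ)⁻¹) ^ Fintype.card J * (1 + 2 ^ Fintype.card J *
        ((Fintype.card B : ℝ) ^ (Fintype.card J - 1) / Fintype.card (A × B))) := by
  set a : ℝ := (Fintype.card A : ℝ) with ha
  set b : ℝ := (Fintype.card B : ℝ) with hb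
  set N : ℝ := (Fintype.card (A × B) : ℝ) with hN
  have ha1 : 1 ≤ a := by
    have := Fintype.card_pos (α := A)
    rw [ha]; exact_mod_cast this
  have hb1 : 1 ≤ b := by
    have := Fintype.card_pos (α := B)
    rw [hb]; exact_mod_cast this
  have hNab : N = a * b := by rw [hN, Fintype.card_prod]; push_cast; rfl
  have hN0 : 0 < N := by rw [hNab]; positivity
  set q := Fintype.card J with hq
  rw [← Finset.sum_fiberwise (s := Finset.univ.filter fun u' => g u' = g u)
    (g := fun u' => Finset.univ.filter fun j => u j ≠ u' j)]
  have hterm : ∀ T : Finset J, ∑ u' ∈ (Finset.univ.filter fun u' => g u' = g u).filter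
      (fun u' => (Finset.univ.filter fun j => u j ≠ u' j) = T),
      (∏ j, pairWeight (u j) (u' j) - a⁻¹ ^ q * a⁻¹ ^ q) ≤
      a⁻¹ ^ q * ((if T = ∅ then 1 else 0) + b ^ (q - 1) / N) := by
    intro T
    rw [Finset.filter_filter, Finset.sum_congr rfl (g := fun _ => a⁻¹ ^ q * a⁻¹ ^ T.card -
      a⁻¹ ^ q * a⁻¹ ^ q) (fun u' hu' => by
        rw [prod_pairWeight, (Finset.mem_filter.1 hu').2.2]), Finset.sum_const, nsmul_eq_mul]
    have hbN : 0 ≤ b ^ (q - 1) / N := by positivity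
    have haq : 0 < a⁻¹ ^ q := by positivity
    by_cases hTe : T = ∅
    · rw [if_pos hTe]
      have hcard : ((Finset.univ.filter fun u' => g u' = g u ∧
          (Finset.univ.filter fun j => u j ≠ u' j) = T).card : ℝ) ≤ 1 := by
        have : (Finset.univ.filter fun u' => g u' = g u ∧
            (Finset.univ.filter fun j => u j ≠ u' j) = T).card ≤ 1 := by
          rw [Finset.card_le_one]
          intro x hx y hy
          simp only [Finset.mem_filter, Finset.mem_univ, true_and, hTe,
            Finset.filter_eq_empty_iff, not_not] at hx hy
          funext j
          rw [← @hx.2 j trivial, @hy.2 j trivial]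
        exact_mod_cast this
      subst hTe
      rw [Finset.card_empty, pow_zero, mul_one]
      have h1 : a⁻¹ ^ q - a⁻¹ ^ q * a⁻¹ ^ q ≤ a⁻¹ ^ q := by nlinarith
      have h2 : 0 ≤ a⁻¹ ^ q - a⁻¹ ^ q * a⁻¹ ^ q := by
        have : a⁻¹ ^ q ≤ 1 := pow_le_one₀ (by positivity) (inv_le_one_of_one_le₀ ha1)
        nlinarith
      calc _ ≤ 1 * (a⁻¹ ^ q - a⁻¹ ^ q * a⁻¹ ^ q) := by gcongr
        _ ≤ a⁻¹ ^ q := by linarith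
        _ ≤ _ := by nlinarith
    · rw [if_neg hTe, zero_add]
      by_cases hTu : T.card = q
      · rw [hTu, sub_self, mul_zero]; positivity
      · have hTne : T.Nonempty := Finset.nonempty_iff_ne_empty.2 hTe
        have hTq : T.card ≤ q - 1 := by
          have := Finset.card_le_univ T
          omega
        have hT1 : 1 ≤ T.card := hTne.card_pos
        have hcard : ((Finset.univ.filter fun u' => g u' = g u ∧
            (Finset.univ.filter fun j => u j ≠ u' j) = T).card : ℝ) ≤ N ^ (T.card - 1) := by
          have := card_same_observation_le g hg u T hTne
          rw [hN]; exact_mod_cast this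
        calc _ ≤ ((Finset.univ.filter fun u' => g u' = g u ∧
              (Finset.univ.filter fun j => u j ≠ u' j) = T).card : ℝ) *
                (a⁻¹ ^ q * a⁻¹ ^ T.card) := by
              gcongr
              have : 0 ≤ a⁻¹ ^ q * a⁻¹ ^ q := by positivity
              linarith
          _ ≤ N ^ (T.card - 1) * (a⁻¹ ^ q * a⁻¹ ^ T.card) := by gcongr
          _ = a⁻¹ ^ q * (b ^ T.card / N) := by
              have h3 : N ^ T.card = N ^ (T.card - 1) * N := by
                rw [← pow_succ, Nat.sub_add_cancel hT1]
              have h4 : N ^ T.card = a ^ T.card * b ^ T.card := by rw [hNab, mul_pow]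
              rw [inv_pow, inv_pow]
              field_simp
              rw [h4.symm, h3]
          _ ≤ a⁻¹ ^ q * (b ^ (q - 1) / N) := by gcongr
  refine (Finset.sum_le_sum fun T _ => hterm T).trans (le_of_eq ?_)
  rw [← Finset.mul_sum, Finset.sum_add_distrib]
  simp [q]

/-- The mean square leakage of a random binning. -/
theorem sum_leakage_sq_le [Nonempty A] [Nonempty B] [Nonempty J] (g : (J → A × B) → Z)
    (hg : ∀ u j, Function.Injective fun x => g (Function.update u j x)) (w : J → A) :
    ∑ π : J → Equiv.Perm (A × B), leakage g π w ^ 2 ≤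
      Fintype.card (J → Equiv.Perm (A × B)) * (Fintype.card Z *
        (((Fintype.card B : ℝ)⁻¹) ^ Fintype.card J +
          2 ^ Fintype.card J / (Fintype.card B * Fintype.card (A × B)))) := by
  set a : ℝ := (Fintype.card A : ℝ) with ha
  set b : ℝ := (Fintype.card B : ℝ) with hb
  set N : ℝ := (Fintype.card (A × B) : ℝ) with hN
  have ha1 : 1 ≤ a := by
    have := Fintype.card_pos (α := A)
    rw [ha]; exact_mod_cast this
  have hb1 : 1 ≤ b := by
    have := Fintype.card_pos (α := B)
    rw [hb]; exact_mod_cast this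
  have hNab : N = a * b := by rw [hN, Fintype.card_prod]; push_cast; rfl
  have hN0 : 0 < N := by rw [hNab]; positivity
  set q := Fintype.card J with hq
  set p : ℝ := (Fintype.card (Equiv.Perm (A × B)) : ℝ) with hp
  have hP : (Fintype.card (J → Equiv.Perm (A × B)) : ℝ) = p ^ q := by
    rw [Fintype.card_fun]; push_cast; rfl
  let I : Z → (J → A × B) → ℝ := fun z u => if g u = z then 1 else 0
  let D : (J → Equiv.Perm (A × B)) → Z → ℝ := fun π z => ∑ u, I z u * ∏ j, hit (π j) (w j) (u j)
  let n : Z → ℝ := fun z => ∑ u, I z u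
  have hbin : ∀ π z, binLaw g π w z = D π z / b ^ q := by
    intro π z
    unfold binLaw
    congr 1
    simp only [D]
    rw [← sum_bin_eq (I z) π w]
    simp [I]
  have hunif : ∀ z, uniformLaw g z = (n z * a⁻¹ ^ q) / b ^ q := by
    intro z
    unfold uniformLaw
    rw [← hN, hNab, mul_pow]
    simp only [n, I, Finset.sum_boole]
    rw [inv_pow]
    field_simp
    simp [q]
  have hleak : ∀ π, leakage g π w ^ 2 ≤
      Fintype.card Z * (∑ z, (D π z - n z * a⁻¹ ^ q) ^ 2) * (b⁻¹ ^ q) ^ 2 := by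
    intro π
    unfold leakage
    refine sq_sum_le_card_mul_sum_sq.trans (le_of_eq ?_)
    rw [Finset.card_univ, mul_assoc, Finset.sum_mul]
    congr 1
    refine Finset.sum_congr rfl fun z _ => ?_
    rw [sq_abs, hbin, hunif, ← sub_div, div_pow, inv_pow b, inv_pow (b ^ q), div_eq_mul_inv]
  -- first and second moments of the bin counts
  have hfirst : ∀ z, ∑ π, D π z = p ^ q * (n z * a⁻¹ ^ q) := by
    intro z
    simp only [D]
    rw [Finset.sum_comm]
    simp_rw [← Finset.mul_sum]
    have : ∀ u : J → A × B, ∑ π : J → Equiv.Perm (A × B), ∏ j, hit (π j) (w j) (u j) =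
        p ^ q * a⁻¹ ^ q := by
      intro u
      rw [← Fintype.prod_sum (fun j (σ : Equiv.Perm (A × B)) => hit σ (w j) (u j))]
      simp_rw [sum_perm_hit]
      rw [Finset.prod_const, Finset.card_univ, mul_pow]
    simp_rw [this, ← Finset.sum_mul]
    simp only [n]
    ring
  have hsecond : ∀ z, ∑ π, D π z ^ 2 ≤
      p ^ q * ∑ u, ∑ u', I z u * I z u' * ∏ j, pairWeight (u j) (u' j) := by
    intro z
    have h1 : ∀ π, D π z ^ 2 = ∑ u, ∑ u', I z u * I z u' *
        ∏ j, (hit (π j) (w j) (u j) * hit (π j) (w j) (u' j)) := by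
      intro π
      simp only [D]
      rw [sq, Finset.sum_mul_sum]
      refine Finset.sum_congr rfl fun u _ => Finset.sum_congr rfl fun u' _ => ?_
      rw [Finset.prod_mul_distrib]
      ring
    simp_rw [h1]
    rw [Finset.sum_comm, Finset.mul_sum]
    refine Finset.sum_le_sum fun u _ => ?_
    rw [Finset.sum_comm, Finset.mul_sum]
    refine Finset.sum_le_sum fun u' _ => ?_
    rw [← Finset.mul_sum, ← Fintype.prod_sum
      (fun j (σ : Equiv.Perm (A × B)) => hit σ (w j) (u j) * hit σ (w j) (u' j))]
    have h2 : ∏ j, ∑ σ : Equiv.Perm (A × B), hit σ (w j) (u j) * hit σ (w j) (u' j) ≤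
        ∏ j, (p * pairWeight (u j) (u' j)) := by
      refine Finset.prod_le_prod (fun j _ => Finset.sum_nonneg fun σ _ => ?_) fun j _ => ?_
      · unfold hit; positivity
      · unfold pairWeight
        by_cases huu : u j = u' j
        · rw [if_pos huu, ← huu]
          simp_rw [hit_mul_self]
          rw [sum_perm_hit]
        · rw [if_neg huu]
          exact sum_perm_hit_mul_hit_le _ huu
    have hI : 0 ≤ I z u * I z u' := by simp only [I]; positivity
    refine (mul_le_mul_of_nonneg_left h2 hI).trans (le_of_eq ?_)
    rw [Finset.prod_mul_distrib, Finset.prod_const, Finset.card_univ]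
    ring
  have hvar : ∀ z, ∑ π, (D π z - n z * a⁻¹ ^ q) ^ 2 ≤ p ^ q * ∑ u, ∑ u', I z u * I z u' *
      (∏ j, pairWeight (u j) (u' j) - a⁻¹ ^ q * a⁻¹ ^ q) := by
    intro z
    have h1 : ∑ π, (D π z - n z * a⁻¹ ^ q) ^ 2 = ∑ π, D π z ^ 2 - p ^ q * (n z * a⁻¹ ^ q) ^ 2 := by
      simp_rw [sub_sq]
      rw [Finset.sum_add_distrib, Finset.sum_sub_distrib, Finset.sum_const, Finset.card_univ,
        nsmul_eq_mul, hP, ← Finset.sum_mul, ← Finset.mul_sum, hfirst]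
      ring
    have h2 : ∑ u, ∑ u', I z u * I z u' * (∏ j, pairWeight (u j) (u' j) - a⁻¹ ^ q * a⁻¹ ^ q) =
        ∑ u, ∑ u', I z u * I z u' * ∏ j, pairWeight (u j) (u' j) - (n z * a⁻¹ ^ q) ^ 2 := by
      simp_rw [mul_sub, Finset.sum_sub_distrib, ← Finset.sum_mul, ← Finset.mul_sum]
      rw [← Finset.sum_mul]
      simp only [n]
      ring
    rw [h1, h2, mul_sub]
    have := hsecond z
    linarith
  have htot : ∑ z, ∑ u, ∑ u', I z u * I z u' *
      (∏ j, pairWeight (u j) (u' j) - a⁻¹ ^ q * a⁻¹ ^ q) ≤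
      b ^ q * (1 + 2 ^ q * (b ^ (q - 1) / N)) := by
    have h1 : ∀ u u' : J → A × B, ∑ z, I z u * I z u' = if g u' = g u then 1 else 0 := by
      intro u u'
      simp [I, eq_comm]
    rw [Finset.sum_comm]
    calc _ = ∑ u, ∑ u' ∈ Finset.univ.filter (fun u' => g u' = g u),
          (∏ j, pairWeight (u j) (u' j) - a⁻¹ ^ q * a⁻¹ ^ q) := by
          refine Finset.sum_congr rfl fun u _ => ?_
          rw [Finset.sum_comm, Finset.sum_filter]
          refine Finset.sum_congr rfl fun u' _ => ?_
          rw [← Finset.sum_mul, h1]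
          split_ifs <;> simp
      _ ≤ ∑ u : J → A × B, a⁻¹ ^ q * (1 + 2 ^ q * (b ^ (q - 1) / N)) :=
          Finset.sum_le_sum fun u _ => sum_pairWeight_sub_le g hg u
      _ = _ := by
          rw [Finset.sum_const, Finset.card_univ, Fintype.card_fun, nsmul_eq_mul, Nat.cast_pow,
            ← hN, ← hq, hNab, mul_pow, inv_pow]
          field_simp
  calc ∑ π, leakage g π w ^ 2
      ≤ ∑ π, Fintype.card Z * (∑ z, (D π z - n z * a⁻¹ ^ q) ^ 2) * (b⁻¹ ^ q) ^ 2 :=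
        Finset.sum_le_sum fun π _ => hleak π
    _ = Fintype.card Z * (b⁻¹ ^ q) ^ 2 * ∑ z, ∑ π, (D π z - n z * a⁻¹ ^ q) ^ 2 := by
        rw [Finset.sum_comm, Finset.mul_sum]
        refine Finset.sum_congr rfl fun π _ => ?_
        ring
    _ ≤ Fintype.card Z * (b⁻¹ ^ q) ^ 2 * (p ^ q * (b ^ q * (1 + 2 ^ q * (b ^ (q - 1) / N)))) := by
        refine mul_le_mul_of_nonneg_left ?_ (by positivity)
        refine (Finset.sum_le_sum fun z _ => hvar z).trans ?_
        rw [← Finset.mul_sum]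
        exact mul_le_mul_of_nonneg_left htot (by positivity)
    _ = _ := by
        rw [hP]
        have hq1 : b ^ q = b ^ (q - 1) * b := by
          rw [← pow_succ, Nat.sub_add_cancel Fintype.card_pos]
        rw [inv_pow]
        field_simp
        rw [hq1]
        ring

end Binning

theorem sum_comp_restrict_ne {ι X : Type*} [Fintype ι] [DecidableEq ι] [Fintype X] (i : ι)
    (f : ({k // k ≠ i} → X) → ℝ) :
    ∑ π : ι → X, f (fun k => π k) = Fintype.card X * ∑ π : {k // k ≠ i} → X, f π := by
  rw [← (Equiv.funSplitAt i X).symm.sum_comp, Fintype.sum_prod_type]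
  have : ∀ (x : X) (y : {k // k ≠ i} → X),
      f (fun k => (Equiv.funSplitAt i X).symm (x, y) k) = f y := by
    intro x y
    congr 1
    funext k
    simp [Equiv.funSplitAt, Equiv.piSplitAt, k.2]
  simp_rw [this]
  rw [Finset.sum_const, Finset.card_univ, nsmul_eq_mul]

/-- Random binning: some choice of the binning permutations makes the average leakage small at all
receivers, if receiver `i` makes a finitely valued observation of the other users' codewords. -/
theorem exists_binning {A B Z : Type*} [Fintype A] [Fintype B] [DecidableEq A] [DecidableEq B]
    [Fintype Z] [DecidableEq Z] [Nonempty A] [Nonempty B] {K : ℕ} (hK : 2 ≤ K)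
    (g : (i : Fin K) → ({k // k ≠ i} → A × B) → Z)
    (hg : ∀ i u j, Function.Injective fun x => g i (Function.update u j x)) :
    ∃ π : Fin K → Equiv.Perm (A × B), ∀ i,
      ((∑ w : {k // k ≠ i} → A, leakage (g i) (fun k => π k) w) /
        Fintype.card ({k // k ≠ i} → A)) ^ 2 ≤ K * (Fintype.card Z *
        (((Fintype.card B : ℝ)⁻¹) ^ (K - 1) +
          2 ^ (K - 1) / (Fintype.card B * Fintype.card (A × B)))) := by
  set δ : ℝ := Fintype.card Z * (((Fintype.card B : ℝ)⁻¹) ^ (K - 1) +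
          2 ^ (K - 1) / (Fintype.card B * Fintype.card (A × B))) with hδ
  have hcard : ∀ i : Fin K, Fintype.card {k // k ≠ i} = K - 1 := by
    intro i; simp
  let W : (i : Fin K) → (Fin K → Equiv.Perm (A × B)) → ℝ := fun i π =>
    (∑ w : {k // k ≠ i} → A, leakage (g i) (fun k => π k) w ^ 2) /
      Fintype.card ({k // k ≠ i} → A)
  have hW : ∀ i, ∑ π, W i π ≤ Fintype.card (Fin K → Equiv.Perm (A × B)) * δ := by
    intro i
    have : Nonempty {k // k ≠ i} := by
      rw [← Fintype.card_pos_iff, hcard]; omega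
    have hA : (0 : ℝ) < Fintype.card ({k // k ≠ i} → A) := by exact_mod_cast Fintype.card_pos
    simp only [W]
    rw [← Finset.sum_div, Finset.sum_comm, div_le_iff₀ hA]
    have h1 : ∀ w : {k // k ≠ i} → A, ∑ π : Fin K → Equiv.Perm (A × B),
        leakage (g i) (fun k => π k) w ^ 2 ≤
        Fintype.card (Fin K → Equiv.Perm (A × B)) * δ := by
      intro w
      rw [sum_comp_restrict_ne i (fun π => leakage (g i) π w ^ 2)]
      have h2 := sum_leakage_sq_le (g i) (hg i) w
      rw [hcard, ← hδ] at h2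
      have h3 : (Fintype.card (Fin K → Equiv.Perm (A × B)) : ℝ) =
          Fintype.card (Equiv.Perm (A × B)) *
            Fintype.card ({k // k ≠ i} → Equiv.Perm (A × B)) := by
        rw [Fintype.card_congr (Equiv.funSplitAt i (Equiv.Perm (A × B))), Fintype.card_prod]
        push_cast; rfl
      rw [h3, mul_assoc]
      exact mul_le_mul_of_nonneg_left h2 (by positivity)
    refine (Finset.sum_le_sum fun w _ => h1 w).trans (le_of_eq ?_)
    rw [Finset.sum_const, Finset.card_univ, nsmul_eq_mul, mul_comm]
  have hW0 : ∀ i π, 0 ≤ W i π := fun i π =>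
    div_nonneg (Finset.sum_nonneg fun w _ => sq_nonneg _) (by positivity)
  obtain ⟨π, -, hπ⟩ := Finset.exists_le_of_sum_le
    (s := (Finset.univ : Finset (Fin K → Equiv.Perm (A × B))))
    (f := fun π => ∑ i, W i π) (g := fun _ => K * δ) Finset.univ_nonempty (by
      rw [Finset.sum_comm]
      refine (Finset.sum_le_sum fun i _ => hW i).trans (le_of_eq ?_)
      simp only [Finset.sum_const, Finset.card_univ, nsmul_eq_mul, Fintype.card_fin]
      ring)
  refine ⟨π, fun i => ?_⟩
  have hA : (0 : ℝ) < Fintype.card ({k // k ≠ i} → A) := by exact_mod_cast Fintype.card_pos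
  refine le_trans ?_ ((Finset.single_le_sum (fun i _ => hW0 i π) (Finset.mem_univ i)).trans hπ)
  simp only [W]
  rw [div_pow, div_le_div_iff₀ (by positivity) hA, sq (Fintype.card ({k // k ≠ i} → A) : ℝ),
    ← mul_assoc]
  refine mul_le_mul_of_nonneg_right ?_ hA.le
  refine sq_sum_le_card_mul_sum_sq.trans (le_of_eq ?_)
  rw [Finset.card_univ, mul_comm]

/-! ### Equivocation of nearly independent messages -/

theorem negMulLog_ge_of_le_one {m : ℕ} (hm : 0 < m) {f : ℝ} (h0 : 0 ≤ f) (h1 : f ≤ 1) :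
    f * Real.log m - max (f - 1 / m) 0 * (1 + Real.log m) ≤ Real.negMulLog f := by
  have hm1 : (1 : ℝ) ≤ m := by exact_mod_cast hm
  have hlm : 0 ≤ Real.log m := Real.log_nonneg hm1
  have hm0 : (0 : ℝ) < m := by positivity
  rcases h0.eq_or_lt with rfl | hf
  · simp
  · set t : ℝ := m * f with ht
    have ht0 : 0 < t := by positivity
    have hlog : Real.log f = Real.log t - Real.log m := by
      rw [ht, Real.log_mul hm0.ne' hf.ne']; ring
    have hkey : f * Real.log t ≤ max (f - 1 / m) 0 * (1 + Real.log m) := by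
      rcases le_or_gt t 1 with h | h
      · have : Real.log t ≤ 0 := Real.log_nonpos ht0.le h
        have h3 : 0 ≤ max (f - 1 / m) 0 * (1 + Real.log m) :=
          mul_nonneg (le_max_right _ _) (by linarith)
        nlinarith
      · have ha : Real.log t ≤ Real.log m := Real.log_le_log ht0 (by rw [ht]; nlinarith)
        have hb : Real.log t ≤ t - 1 := Real.log_le_sub_one_of_pos ht0
        have hc : t * Real.log t ≤ (t - 1) * (1 + Real.log m) := by nlinarith
        have hd : (t - 1) * (1 + Real.log m) = m * ((f - 1 / m) * (1 + Real.log m)) := by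
          rw [ht]; field_simp
        have he : f * Real.log t ≤ (f - 1 / m) * (1 + Real.log m) := by
          refine le_of_mul_le_mul_left ?_ hm0
          rw [← hd, ← mul_assoc, ← ht]
          exact hc
        refine he.trans (mul_le_mul_of_nonneg_right (le_max_left _ _) (by linarith))
    rw [Real.negMulLog, hlog]
    linarith

/-- If, on average over the values `a` of `X`, no event decided by `Y` is more likely jointly with
`X = a` than under independence of `Y` and a uniform `X`, up to `ε`, then the conditional entropy
of `X` given `Y` is nearly maximal. -/
theorem condEntropy_ge {Ω A B : Type*} [MeasurableSpace Ω] [Fintype A] [MeasurableSpace B]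
    (μ : Measure Ω) [IsProbabilityMeasure μ] (X : Ω → A) (Y : Ω → B)
    (hX : ∀ a, MeasurableSet (X ⁻¹' {a})) (hY : Measurable Y) {ε : ℝ} (hm : 0 < Fintype.card A)
    (hε : ∀ S : A → Set B, (∀ a, MeasurableSet (S a)) →
      ∑ a, (μ.real (X ⁻¹' {a} ∩ Y ⁻¹' S a) - μ.real (Y ⁻¹' S a) / Fintype.card A) ≤ ε) :
    (Real.log (Fintype.card A) - ε * (1 + Real.log (Fintype.card A))) / Real.log 2 ≤
      condEntropy μ X Y := by
  set m := Fintype.card A with hmdef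
  have hm1 : (1 : ℝ) ≤ m := by exact_mod_cast hm
  have hlm : 0 ≤ Real.log m := Real.log_nonneg hm1
  have hcomap : MeasurableSpace.comap Y inferInstance ≤ (inferInstance : MeasurableSpace Ω) :=
    hY.comap_le
  let φ : A → Ω → ℝ := fun a => (X ⁻¹' {a}).indicator (fun _ => (1 : ℝ))
  have hφint : ∀ a, Integrable (φ a) μ := fun a => (integrable_const _).indicator (hX a)
  let f : A → Ω → ℝ := fun a => μ[φ a | MeasurableSpace.comap Y inferInstance]
  have hf0 : ∀ a, ∀ᵐ ω ∂μ, 0 ≤ f a ω := by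
    intro a
    have : (0 : Ω → ℝ) ≤ᵐ[μ] φ a :=
      Eventually.of_forall fun ω => Set.indicator_nonneg (fun _ _ => zero_le_one) ω
    exact condExp_nonneg this
  have hf1 : ∀ a, ∀ᵐ ω ∂μ, f a ω ≤ 1 := by
    intro a
    have h1 : φ a ≤ᵐ[μ] fun _ => (1 : ℝ) := Eventually.of_forall fun ω =>
      Set.indicator_le_self' (fun _ _ => zero_le_one) ω
    have h2 := condExp_mono (m := MeasurableSpace.comap Y inferInstance) (hφint a)
      (integrable_const (1 : ℝ)) h1
    rw [condExp_const hcomap] at h2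
    exact h2
  have hfm : ∀ a, StronglyMeasurable[MeasurableSpace.comap Y inferInstance] (f a) :=
    fun a => stronglyMeasurable_condExp
  have hfm' : ∀ a, StronglyMeasurable (f a) := fun a => (hfm a).mono hcomap
  have hfint : ∀ a, Integrable (f a) μ := fun a => integrable_condExp
  have hnint : ∀ a, Integrable (fun ω => Real.negMulLog (f a ω)) μ := by
    intro a
    refine Integrable.of_bound
      (Real.continuous_negMulLog.comp_stronglyMeasurable (hfm' a)).aestronglyMeasurable 1 ?_
    filter_upwards [hf0 a, hf1 a] with ω h0 h1
    rw [Real.norm_of_nonneg (Real.negMulLog_nonneg h0 h1)]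
    have := Real.negMulLog_le_one_sub_self h0
    linarith
  have hmaxint : ∀ a, Integrable (fun ω => max (f a ω - 1 / m) 0) μ := fun a =>
    ((hfint a).sub (integrable_const _)).pos_part
  have hmass : ∑ a, ∫ ω, f a ω ∂μ = 1 := by
    have h1 : ∀ a, ∫ ω, f a ω ∂μ = μ.real (X ⁻¹' {a}) := by
      intro a
      rw [integral_condExp hcomap, integral_indicator_const _ (hX a)]
      simp
    simp_rw [h1]
    rw [sum_measureReal_preimage_singleton _ (fun a _ => hX a)]
    simp
  have hex : ∀ a, ∃ S : Set B, MeasurableSet S ∧ Y ⁻¹' S = {ω | 1 / (m : ℝ) < f a ω} := fun a =>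
    (hfm a).measurable measurableSet_Ioi
  choose S hSm hS using hex
  have hmax : ∀ a, ∫ ω, max (f a ω - 1 / m) 0 ∂μ =
      μ.real (X ⁻¹' {a} ∩ Y ⁻¹' S a) - μ.real (Y ⁻¹' S a) / m := by
    intro a
    have hSY : MeasurableSet (Y ⁻¹' S a) := hY (hSm a)
    have h1 : (fun ω => max (f a ω - 1 / m) 0) =
        (Y ⁻¹' S a).indicator (fun ω => f a ω - 1 / m) := by
      funext ω
      by_cases h : 1 / (m : ℝ) < f a ω
      · have hω : ω ∈ Y ⁻¹' S a := by rw [hS]; exact h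
        rw [Set.indicator_of_mem hω, max_eq_left (by linarith)]
      · have hω : ω ∉ Y ⁻¹' S a := by rw [hS]; exact h
        rw [Set.indicator_of_notMem hω, max_eq_right (by linarith)]
    rw [h1, integral_indicator hSY, integral_sub (hfint a).integrableOn
      (integrable_const _).integrableOn, setIntegral_condExp hcomap (hφint a) ⟨S a, hSm a, rfl⟩,
      integral_indicator_const _ (hX a)]
    simp only [integral_const, smul_eq_mul, mul_one, measureReal_restrict_apply_univ,
      measureReal_restrict_apply (hX a)]
    ring
  have hlow : Real.log m - (∑ a, ∫ ω, max (f a ω - 1 / m) 0 ∂μ) * (1 + Real.log m) ≤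
      ∑ a, ∫ ω, Real.negMulLog (f a ω) ∂μ := by
    have h1 : ∀ a, (∫ ω, f a ω ∂μ) * Real.log m - (∫ ω, max (f a ω - 1 / m) 0 ∂μ) *
        (1 + Real.log m) ≤ ∫ ω, Real.negMulLog (f a ω) ∂μ := by
      intro a
      rw [← integral_mul_const, ← integral_mul_const,
        ← integral_sub ((hfint a).mul_const _) ((hmaxint a).mul_const _)]
      refine integral_mono_ae (((hfint a).mul_const _).sub ((hmaxint a).mul_const _)) (hnint a) ?_
      filter_upwards [hf0 a, hf1 a] with ω h0 h1
      exact negMulLog_ge_of_le_one hm h0 h1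
    refine le_trans (le_of_eq ?_) (Finset.sum_le_sum fun a _ => h1 a)
    rw [Finset.sum_sub_distrib, ← Finset.sum_mul, ← Finset.sum_mul, hmass, one_mul]
  have hcond : condEntropy μ X Y = (∑ a, ∫ ω, Real.negMulLog (f a ω) ∂μ) / Real.log 2 := by
    unfold condEntropy
    rw [integral_finsetSum _ (fun a _ => (hnint a).div_const _), Finset.sum_div]
    exact Finset.sum_congr rfl fun a _ => integral_div _ _
  rw [hcond]
  refine div_le_div_of_nonneg_right (le_trans ?_ hlow) (Real.log_nonneg (by norm_num))
  have h2 : ∑ a, ∫ ω, max (f a ω - 1 / m) 0 ∂μ ≤ ε := by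
    simp_rw [hmax]
    exact hε S hSm
  nlinarith

theorem entropy_eq_of_uniform {Ω A : Type*} [MeasurableSpace Ω] [Fintype A] [Nonempty A]
    (μ : Measure Ω) (X : Ω → A) (h : ∀ a, μ.real (X ⁻¹' {a}) = 1 / Fintype.card A) :
    entropy μ X = Real.log (Fintype.card A) / Real.log 2 := by
  unfold entropy
  simp_rw [h]
  rw [Finset.sum_const, Finset.card_univ, nsmul_eq_mul, Real.negMulLog, one_div, Real.log_inv]
  have : (Fintype.card A : ℝ) ≠ 0 := by exact_mod_cast Fintype.card_ne_zero
  field_simp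

/-! ### Output laws and equivocation of codebooks -/

instance : IsProbabilityMeasure complexGaussian := by
  unfold complexGaussian
  refine Measure.isProbabilityMeasure_map ?_
  exact (Complex.measurableEquivRealProd.symm.measurable).aemeasurable

instance (n F : ℕ) : IsProbabilityMeasure (noise n F) := by
  unfold noise; infer_instance

theorem measurable_received {K n F : ℕ} (h : Channel K) (i : Fin K) :
    Measurable fun p : (Fin K → Signal n F) × Signal n F => received h i p.1 p.2 := by
  unfold received
  fun_prop

instance {K n F : ℕ} {M : Fin K → ℕ} (C : SecretCodebook K n F M) (h : Channel K) (i : Fin K)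
    (w : (k : Fin K) → Fin (M k)) : IsProbabilityMeasure (C.outputLaw h i w) := by
  have := C.enc_prob
  unfold SecretCodebook.outputLaw
  exact Measure.isProbabilityMeasure_map (measurable_received h i).aemeasurable

theorem jointLaw_real_apply {K n F : ℕ} {M : Fin K → ℕ} (C : SecretCodebook K n F M)
    (h : Channel K) (i : Fin K) {E : Set (((k : Fin K) → Fin (M k)) × Signal n F)}
    (hE : MeasurableSet E) :
    (C.jointLaw h i).real E =
      (∑ w, (C.outputLaw h i w).real {y | (w, y) ∈ E}) / ∏ k, (M k : ℝ) := by
  unfold SecretCodebook.jointLaw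
  rw [measureReal_ennreal_smul_apply, measureReal_def, Measure.finsetSum_apply,
    ENNReal.toReal_sum (fun w _ => measure_ne_top _ _), div_eq_inv_mul]
  congr 1
  · simp [ENNReal.toReal_inv, ENNReal.toReal_prod]
  · refine Finset.sum_congr rfl fun w _ => ?_
    rw [Measure.map_apply measurable_prodMk_left hE]
    rfl

theorem isProbabilityMeasure_jointLaw {K n F : ℕ} {M : Fin K → ℕ} (C : SecretCodebook K n F M)
    (h : Channel K) (i : Fin K) (hM : ∀ k, 0 < M k) :
    IsProbabilityMeasure (C.jointLaw h i) := by
  have h1 := jointLaw_real_apply C h i MeasurableSet.univ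
  have hM' : ∏ k, (M k : ℝ) ≠ 0 :=
    Finset.prod_ne_zero_iff.2 fun k _ => by exact_mod_cast (hM k).ne'
  have h2 : (C.jointLaw h i).real Set.univ = 1 := by
    rw [h1]
    simp only [Set.mem_univ, Set.ofPred_true, probReal_univ, Finset.sum_const, Finset.card_univ,
      Fintype.card_pi, Fintype.card_fin, nsmul_eq_mul, mul_one, Nat.cast_prod]
    exact div_self hM'
  refine ⟨?_⟩
  rw [measureReal_def] at h2
  rw [← ENNReal.ofReal_toReal (a := C.jointLaw h i Set.univ) (by
    intro htop; rw [htop] at h2; simp at h2), h2, ENNReal.ofReal_one]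

/-- The message of a user outside `S` is independent of the messages of the users in `S`. -/
theorem sum_messages_eq {K : ℕ} {M : Fin K → ℕ} (S : Finset (Fin K)) {i : Fin K}
    (hi : i ∉ S) (f : Fin (M i) → ((k : S) → Fin (M k)) → ℝ) :
    (Fintype.card ((k : S) → Fin (M k)) : ℝ) *
      ∑ w : (k : Fin K) → Fin (M k), f (w i) (fun k => w k) =
      ∑ a, ∑ w : (k : Fin K) → Fin (M k), f (w i) a := by
  have h : ∀ F : ((k : S) → Fin (M k)) → Fin (M i) → ℝ,
      ∑ w : (k : Fin K) → Fin (M k), F (fun k => w k) (w i) =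
      ∑ a, ∑ b : (k : {k // k ∉ S}) → Fin (M k), F a (b ⟨i, hi⟩) := by
    intro F
    rw [← Fintype.sum_prod_type',
      ← (Equiv.piEquivPiSubtypeProd (fun k => k ∈ S) (fun k => Fin (M k))).sum_comp]
    rfl
  rw [h (fun a b => f b a)]
  have h2 : ∀ a, ∑ w : (k : Fin K) → Fin (M k), f (w i) a =
      (Fintype.card ((k : S) → Fin (M k)) : ℝ) *
        ∑ b : (k : {k // k ∉ S}) → Fin (M k), f (b ⟨i, hi⟩) a := by
    intro a
    rw [h (fun _ b => f b a), Finset.sum_const, Finset.card_univ, nsmul_eq_mul]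
  simp_rw [h2]
  rw [← Finset.mul_sum]

/-- If the law of the output at receiver `i` depends, up to a total variation error of small mean,
only on the message of user `i`, then the messages of the other users are nearly perfectly
hidden from receiver `i`. -/
theorem equivocation_ge {K n F : ℕ} {M : Fin K → ℕ} (C : SecretCodebook K n F M)
    (h : Channel K) (i : Fin K) (hM : ∀ k, 0 < M k) (Q : Fin (M i) → Set (Signal n F) → ℝ)
    (l : ((k : Fin K) → Fin (M k)) → ℝ) {δ : ℝ} (hδ : 0 ≤ δ)
    (hQ : ∀ w T, MeasurableSet T → |(C.outputLaw h i w).real T - Q (w i) T| ≤ l w)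
    (hl : ∑ w, l w ≤ δ * ∏ k, (M k : ℝ)) {S : Finset (Fin K)} (hi : i ∉ S) :
    1 - 6 * δ ≤ C.equivocation h S i := by
  classical
  have hprob := isProbabilityMeasure_jointLaw C h i hM
  have hne : ∀ k, Nonempty (Fin (M k)) := fun k => ⟨⟨0, hM k⟩⟩
  have hPi : (0 : ℝ) < ∏ k, (M k : ℝ) :=
    Finset.prod_pos fun k _ => by exact_mod_cast hM k
  set m := Fintype.card ((k : S) → Fin (M k)) with hm
  have hm0 : 0 < m := Fintype.card_pos
  have hmR : (0 : ℝ) < m := by exact_mod_cast hm0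
  have hXm : Measurable (SecretCodebook.messages (n := n) (F := F) (M := M) S) := by
    unfold SecretCodebook.messages
    fun_prop
  have hX : ∀ a, MeasurableSet (SecretCodebook.messages (n := n) (F := F) (M := M) S ⁻¹' {a}) :=
    fun a => hXm (measurableSet_singleton a)
  have hmsg : ∀ (w : (k : Fin K) → Fin (M k)) (y : Signal n F),
      SecretCodebook.messages S (w, y) = fun k : S => w k := fun _ _ => rfl
  have hunif : ∀ a, (C.jointLaw h i).real (SecretCodebook.messages S ⁻¹' {a}) = 1 / m := by
    intro a
    rw [jointLaw_real_apply C h i (hX a)]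
    have h1 : ∀ w : (k : Fin K) → Fin (M k), (C.outputLaw h i w).real
        {y | (w, y) ∈ SecretCodebook.messages S ⁻¹' {a}} =
        if (fun k : S => w k) = a then 1 else 0 := by
      intro w
      by_cases hw : (fun k : S => w k) = a
      · simp [hmsg, hw]
      · simp [hmsg, hw]
    simp_rw [h1]
    have h2 := sum_messages_eq (M := M) S hi (fun _ a' => if a' = a then 1 else 0)
    simp only [Finset.sum_const, Finset.card_univ, nsmul_eq_mul, Fintype.card_pi, Fintype.card_fin,
      Nat.cast_prod, mul_ite, mul_one, mul_zero, Finset.sum_ite_eq', Finset.mem_univ,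
      if_true] at h2
    rw [div_eq_div_iff hPi.ne' hmR.ne', one_mul, ← h2, mul_comm]
    simp [hm]
  have hent := entropy_eq_of_uniform (C.jointLaw h i) (SecretCodebook.messages S) hunif
  have hcond := condEntropy_ge (C.jointLaw h i) (SecretCodebook.messages S) Prod.snd hX
    measurable_snd (ε := 2 * δ) hm0 (by
      intro T hT
      have h1 : ∀ a, (C.jointLaw h i).real
          (SecretCodebook.messages S ⁻¹' {a} ∩ Prod.snd ⁻¹' T a) =
          (∑ w : (k : Fin K) → Fin (M k), if (fun k : S => w k) = a then
            (C.outputLaw h i w).real (T a) else 0) / ∏ k, (M k : ℝ) := by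
        intro a
        rw [jointLaw_real_apply C h i ((hX a).inter (measurable_snd (hT a)))]
        congr 1
        refine Finset.sum_congr rfl fun w _ => ?_
        by_cases hw : (fun k : S => w k) = a
        · simp [hmsg, hw]
        · simp [hmsg, hw]
      have h2 : ∀ a, (C.jointLaw h i).real (Prod.snd ⁻¹' T a) =
          (∑ w : (k : Fin K) → Fin (M k), (C.outputLaw h i w).real (T a)) /
            ∏ k, (M k : ℝ) := by
        intro a
        rw [jointLaw_real_apply C h i (measurable_snd (hT a))]
        rfl
      have h3 : ∑ a, (C.jointLaw h i).real
          (SecretCodebook.messages S ⁻¹' {a} ∩ Prod.snd ⁻¹' T a) =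
          (∑ w : (k : Fin K) → Fin (M k), (C.outputLaw h i w).real (T fun k => w k)) /
            ∏ k, (M k : ℝ) := by
        simp_rw [h1]
        rw [← Finset.sum_div, Finset.sum_comm]
        simp
      have hup : ∑ w : (k : Fin K) → Fin (M k), (C.outputLaw h i w).real (T fun k => w k) ≤
          ∑ w : (k : Fin K) → Fin (M k), Q (w i) (T fun k => w k) + ∑ w, l w := by
        rw [← Finset.sum_add_distrib]
        refine Finset.sum_le_sum fun w _ => ?_
        have := (abs_le.1 (hQ w _ (hT fun k => w k))).2
        linarith
      have hlo : ∀ a, ∑ w : (k : Fin K) → Fin (M k), Q (w i) (T a) - ∑ w, l w ≤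
          ∑ w : (k : Fin K) → Fin (M k), (C.outputLaw h i w).real (T a) := by
        intro a
        rw [← Finset.sum_sub_distrib]
        refine Finset.sum_le_sum fun w _ => ?_
        have := (abs_le.1 (hQ w _ (hT a))).1
        linarith
      have hind := sum_messages_eq (M := M) S hi (fun b a => Q b (T a))
      have hlo' : m * ∑ w : (k : Fin K) → Fin (M k), Q (w i) (T fun k => w k) - m * ∑ w, l w ≤
          ∑ a, ∑ w : (k : Fin K) → Fin (M k), (C.outputLaw h i w).real (T a) := by
        refine le_trans (le_of_eq ?_) (Finset.sum_le_sum fun a _ => hlo a)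
        rw [Finset.sum_sub_distrib, ← hind]
        simp [hm]
      rw [Finset.sum_sub_distrib, h3]
      simp_rw [h2]
      rw [← Finset.sum_div, ← Finset.sum_div, div_sub_div _ _ hPi.ne' hmR.ne',
        div_le_iff₀ (by positivity)]
      have e1 : (∑ a, ∑ w : (k : Fin K) → Fin (M k), (C.outputLaw h i w).real (T a)) /
          ∏ k, (M k : ℝ) = (∏ k, (M k : ℝ))⁻¹ *
          (∑ a, ∑ w : (k : Fin K) → Fin (M k), (C.outputLaw h i w).real (T a)) :=
        div_eq_inv_mul _ _
      rw [mul_div_cancel₀ _ hPi.ne']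
      nlinarith)
  unfold SecretCodebook.equivocation
  split_ifs with h0
  · linarith
  · rw [hent] at h0 ⊢
    have hl2 : 0 < Real.log 2 := Real.log_pos (by norm_num)
    have hlm : 0 < Real.log m := by
      refine lt_of_le_of_ne (Real.log_nonneg (by exact_mod_cast hm0)) fun h => h0 ?_
      rw [← hm, ← h, zero_div]
    have hm2 : (2 : ℝ) ≤ m := by
      have h1 : m ≠ 1 := by
        rintro h1
        rw [h1] at hlm
        simp at hlm
      exact_mod_cast (by omega : 2 ≤ m)
    have hlm2 : Real.log 2 ≤ Real.log m := Real.log_le_log (by norm_num) hm2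
    have hl2' := Real.log_two_gt_d9
    rw [← hm, le_div_iff₀ (by positivity)]
    refine le_trans ?_ hcond
    rw [← hm, mul_div_assoc', div_le_div_iff_of_pos_right hl2]
    nlinarith

/-- The encoder of user `k` sends the codeword with index `π k (w, r)`, where `w` is the message
and `r` is uniform. -/
def binnedCodebook {K n F a b : ℕ} [NeZero b] (X : Fin a × Fin b → Signal n F)
    (π : Fin K → Equiv.Perm (Fin a × Fin b)) (dec : Fin K → Signal n F → Fin a)
    (hdec : ∀ k, Measurable (dec k)) : SecretCodebook K n F (fun _ => a) where
  enc k w := (uniformOn (Set.univ : Set (Fin b))).map fun r => X (π k (w, r))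
  enc_prob k w := by
    have : IsProbabilityMeasure (uniformOn (Set.univ : Set (Fin b))) :=
      isProbabilityMeasure_uniformOn Set.finite_univ Set.univ_nonempty
    exact Measure.isProbabilityMeasure_map (measurable_of_finite _).aemeasurable
  dec := dec
  dec_measurable := hdec

theorem binnedCodebook_outputLaw {K n F a b : ℕ} [NeZero b] (X : Fin a × Fin b → Signal n F)
    (π : Fin K → Equiv.Perm (Fin a × Fin b)) (dec : Fin K → Signal n F → Fin a)
    (hdec : ∀ k, Measurable (dec k)) (h : Channel K) (i : Fin K) (w : Fin K → Fin a)
    {T : Set (Signal n F)} (hT : MeasurableSet T) :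
    ((binnedCodebook X π dec hdec).outputLaw h i w).real T =
      (∑ r : Fin K → Fin b, (noise n F).real
        {z | received h i (fun k => X (π k (w k, r k))) z ∈ T}) / (b : ℝ) ^ K := by
  have hpr : IsProbabilityMeasure (uniformOn (Set.univ : Set (Fin b))) :=
    isProbabilityMeasure_uniformOn Set.finite_univ Set.univ_nonempty
  unfold SecretCodebook.outputLaw binnedCodebook
  simp only
  rw [measureReal_def, Measure.map_apply (measurable_received h i) hT,
    Measure.prod_apply (measurable_received h i hT),
    ← Measure.pi_map_pi (fun k => (measurable_of_finite _).aemeasurable),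
    lintegral_map (measurable_measure_prodMk_left (measurable_received h i hT))
      (measurable_of_finite _), lintegral_fintype, ENNReal.toReal_sum]
  · rw [Finset.sum_div]
    refine Finset.sum_congr rfl fun r _ => ?_
    rw [ENNReal.toReal_mul, div_eq_mul_inv]
    congr 1
    rw [Measure.pi_singleton]
    simp [uniformOn_univ]
  · intro r _
    exact ENNReal.mul_ne_top (measure_ne_top _ _) (measure_ne_top _ _)

/-- Processing the observation, together with the codeword of user `i` and with noise, does not
increase the leakage. -/
theorem abs_sub_le_leakage {A B Z : Type*} [Fintype A] [Fintype B] [DecidableEq A] [DecidableEq B]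
    [Fintype Z] [DecidableEq Z] [Nonempty B] {K : ℕ} (i : Fin K)
    (g : ({k // k ≠ i} → A × B) → Z) (π : Fin K → Equiv.Perm (A × B)) (w : Fin K → A)
    (Φ : A × B → Z → ℝ) (h0 : ∀ u z, 0 ≤ Φ u z) (h1 : ∀ u z, Φ u z ≤ 1) :
    |(∑ r : Fin K → B, Φ (π i (w i, r i)) (g fun k => π k (w k, r k))) /
        (Fintype.card B : ℝ) ^ K -
      (∑ b : B, ∑ z, uniformLaw g z * Φ (π i (w i, b)) z) / Fintype.card B| ≤
      leakage g (fun k => π k) (fun k => w k) := by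
  have hB : (0 : ℝ) < Fintype.card B := by exact_mod_cast Fintype.card_pos
  have hcard : Fintype.card {k // k ≠ i} = K - 1 := by simp
  have hK : K - 1 + 1 = K := by have := i.isLt; omega
  have hsplit : (∑ r : Fin K → B, Φ (π i (w i, r i)) (g fun k => π k (w k, r k))) /
      (Fintype.card B : ℝ) ^ K =
      (∑ b : B, ∑ z, binLaw g (fun k => π k) (fun k => w k) z * Φ (π i (w i, b)) z) /
        Fintype.card B := by
    have e1 : ∑ r : Fin K → B, Φ (π i (w i, r i)) (g fun k => π k (w k, r k)) =
        ∑ b : B, ∑ r : {k // k ≠ i} → B, Φ (π i (w i, b)) (g fun k => π k (w k, r k)) := by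
      rw [← (Equiv.funSplitAt i B).symm.sum_comp, Fintype.sum_prod_type]
      refine Finset.sum_congr rfl fun b _ => Finset.sum_congr rfl fun r _ => ?_
      have e2 : (Equiv.funSplitAt i B).symm (b, r) i = b := by
        simp [Equiv.funSplitAt, Equiv.piSplitAt]
      have e3 : (fun k : {k // k ≠ i} => (π k) (w k, (Equiv.funSplitAt i B).symm (b, r) k)) =
          fun k : {k // k ≠ i} => (π k) (w k, r k) := by
        funext k
        simp [Equiv.funSplitAt, Equiv.piSplitAt, k.2]
      rw [e2, e3]
    have e4 : ∀ b, ∑ r : {k // k ≠ i} → B, Φ (π i (w i, b)) (g fun k => π k (w k, r k)) =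
        (∑ z, binLaw g (fun k => π k) (fun k => w k) z * Φ (π i (w i, b)) z) *
          (Fintype.card B : ℝ) ^ (K - 1) := by
      intro b
      rw [← Finset.sum_fiberwise Finset.univ
        (fun r : {k // k ≠ i} → B => g fun k => π k (w k, r k)), Finset.sum_mul]
      refine Finset.sum_congr rfl fun z _ => ?_
      rw [Finset.sum_congr rfl (g := fun _ => Φ (π i (w i, b)) z) (fun r hr => by
        rw [(Finset.mem_filter.1 hr).2]), Finset.sum_const, nsmul_eq_mul]
      unfold binLaw
      rw [hcard]
      field_simp
    rw [e1]
    simp_rw [e4]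
    rw [← Finset.sum_mul]
    have hpow : (Fintype.card B : ℝ) ^ K =
        (Fintype.card B : ℝ) ^ (K - 1) * Fintype.card B := by rw [← pow_succ, hK]
    rw [hpow]
    field_simp
  rw [hsplit, ← sub_div, ← Finset.sum_sub_distrib, abs_div, abs_of_pos hB, div_le_iff₀ hB]
  refine (Finset.abs_sum_le_sum_abs _ _).trans ?_
  have hb : ∀ b : B, |∑ z, binLaw g (fun k => π k) (fun k => w k) z * Φ (π i (w i, b)) z -
      ∑ z, uniformLaw g z * Φ (π i (w i, b)) z| ≤ leakage g (fun k => π k) (fun k => w k) := by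
    intro b
    rw [← Finset.sum_sub_distrib]
    refine (Finset.abs_sum_le_sum_abs _ _).trans ?_
    unfold leakage
    refine Finset.sum_le_sum fun z _ => ?_
    rw [← sub_mul, abs_mul, abs_of_nonneg (h0 _ _)]
    exact mul_le_of_le_one_right (abs_nonneg _) (h1 _ _)
  refine (Finset.sum_le_sum fun b _ => hb b).trans (le_of_eq ?_)
  rw [Finset.sum_const, Finset.card_univ, nsmul_eq_mul, mul_comm]

/-! ### Lattice modulation along aligned beams -/

/-- The Gaussian integer with real part `p.1` and imaginary part `p.2`. -/
def symVal {q : ℕ} (p : Fin q × Fin q) : ℂ := ⟨(p.1 : ℕ), (p.2 : ℕ)⟩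

theorem norm_symVal_le {q : ℕ} (p : Fin q × Fin q) : ‖symVal p‖ ≤ 2 * q := by
  refine (Complex.norm_le_abs_re_add_abs_im _).trans ?_
  have h1 : ((p.1 : ℕ) : ℝ) ≤ q := by exact_mod_cast p.1.isLt.le
  have h2 : ((p.2 : ℕ) : ℝ) ≤ q := by exact_mod_cast p.2.isLt.le
  simp only [symVal, Nat.abs_cast]
  linarith

/-- The transmitted signal: the symbols `x t α`, scaled by `c`, are sent along the beams `v α`. -/
def modulate {n F q : ℕ} {D : Type} [Fintype D] (c : ℝ) (v : D → Fin F → ℂ)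
    (x : Fin n → D → Fin q × Fin q) : Signal n F :=
  fun t f => c * ∑ α, v α f * symVal (x t α)

theorem norm_modulate_sq_le {n F q : ℕ} {D : Type} [Fintype D] {c : ℝ} (hc : 0 ≤ c)
    (v : D → Fin F → ℂ) (x : Fin n → D → Fin q × Fin q) (t : Fin n) (f : Fin F) :
    ‖modulate c v x t f‖ ^ 2 ≤ (2 * c * ∑ α, ∑ f, ‖v α f‖) ^ 2 * q ^ 2 := by
  rw [← mul_pow]
  refine pow_le_pow_left₀ (norm_nonneg _) ?_ 2
  unfold modulate
  rw [norm_mul, Complex.norm_of_nonneg hc]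
  have h1 : ‖∑ α, v α f * symVal (x t α)‖ ≤ ∑ α, (∑ f, ‖v α f‖) * (2 * q) := by
    refine (norm_sum_le _ _).trans (Finset.sum_le_sum fun α _ => ?_)
    rw [norm_mul]
    exact mul_le_mul (Finset.single_le_sum (f := fun f => ‖v α f‖)
      (fun f _ => norm_nonneg _) (Finset.mem_univ f)) (norm_symVal_le _) (norm_nonneg _)
      (Finset.sum_nonneg fun f _ => norm_nonneg _)
  rw [← Finset.sum_mul] at h1
  calc _ ≤ c * ((∑ α, ∑ f, ‖v α f‖) * (2 * q)) := mul_le_mul_of_nonneg_left h1 hc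
    _ = _ := by ring

section Interference

variable {K q : ℕ} {D E : Type} [Fintype D] [DecidableEq E] (i : Fin K)

theorem sum_aligned_lt (σ : Fin K → D → E) (y : {k // k ≠ i} → D → Fin q) (β : E) :
    ∑ k : {k // k ≠ i}, ∑ α, (if σ k α = β then (y k α : ℕ) else 0) <
      K * Fintype.card D * q + 1 := by
  rw [Nat.lt_succ_iff]
  calc _ ≤ ∑ k : {k // k ≠ i}, ∑ _α : D, q := by
        refine Finset.sum_le_sum fun k _ => Finset.sum_le_sum fun α _ => ?_
        split_ifs
        · exact (y k α).isLt.le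
        · exact Nat.zero_le _
    _ = Fintype.card {k // k ≠ i} * (Fintype.card D * q) := by simp
    _ ≤ K * (Fintype.card D * q) := by
        refine Nat.mul_le_mul_right _ ?_
        simp
    _ = _ := by ring

/-- The sum of the symbols that the users other than `i` send along the beams aligned at `β`. -/
def alignedSum (σ : Fin K → D → E) (y : {k // k ≠ i} → D → Fin q) (β : E) :
    Fin (K * Fintype.card D * q + 1) :=
  ⟨∑ k : {k // k ≠ i}, ∑ α, if σ k α = β then (y k α : ℕ) else 0, sum_aligned_lt i σ y β⟩

theorem alignedSum_update_injective (σ : Fin K → D → E) (hσ : ∀ k, Function.Injective (σ k))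
    (y : {k // k ≠ i} → D → Fin q) (k0 : {k // k ≠ i}) :
    Function.Injective fun a => alignedSum i σ (Function.update y k0 a) := by
  classical
  intro a a' haa
  funext α
  have hval : ∀ b : D → Fin q, (alignedSum i σ (Function.update y k0 b) (σ k0 α) : ℕ) =
      b α + ∑ k ∈ Finset.univ.erase k0,
        ∑ α', if σ k α' = σ k0 α then (y k α' : ℕ) else 0 := by
    intro b
    simp only [alignedSum]
    rw [← Finset.add_sum_erase _ _ (Finset.mem_univ k0)]
    congr 1
    · simp [(hσ k0).eq_iff]
    · refine Finset.sum_congr rfl fun k hk => ?_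
      rw [Function.update_of_ne (Finset.ne_of_mem_erase hk)]
  have h1 := congrArg Fin.val (congrFun haa (σ k0 α))
  simp only [hval] at h1
  exact Fin.ext (by omega)

/-- The symbol sums at receiver `i`, for real and imaginary parts, in all time slots. This is a
noiseless version of what receiver `i` can learn about the other users. -/
def interference {n : ℕ} (σ : Fin K → D → E) (x : {k // k ≠ i} → Fin n → D → Fin q × Fin q)
    (t : Fin n) (β : E) :
    Fin (K * Fintype.card D * q + 1) × Fin (K * Fintype.card D * q + 1) :=
  (alignedSum i σ (fun k α => (x k t α).1) β, alignedSum i σ (fun k α => (x k t α).2) β)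

theorem interference_update_injective {n : ℕ} (σ : Fin K → D → E)
    (hσ : ∀ k, Function.Injective (σ k))
    (x : {k // k ≠ i} → Fin n → D → Fin q × Fin q) (k0 : {k // k ≠ i}) :
    Function.Injective fun a => interference i σ (Function.update x k0 a) := by
  intro a a' haa
  funext t
  have hup : ∀ (pr : Fin q × Fin q → Fin q) (b : Fin n → D → Fin q × Fin q),
      (fun (k : {k // k ≠ i}) α => pr (Function.update x k0 b k t α)) =
      Function.update (fun k α => pr (x k t α)) k0 (fun α => pr (b t α)) := by
    intro pr b
    funext k
    by_cases hk : k = k0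
    · subst hk; simp
    · simp [Function.update_of_ne hk]
  have h1 : (fun α => (a t α).1) = fun α => (a' t α).1 := by
    apply alignedSum_update_injective i σ hσ (fun k α => (x k t α).1) k0
    funext β
    have := congrArg Prod.fst (congrFun (congrFun haa t) β)
    simpa only [interference, hup Prod.fst] using this
  have h2 : (fun α => (a t α).2) = fun α => (a' t α).2 := by
    apply alignedSum_update_injective i σ hσ (fun k α => (x k t α).2) k0
    funext β
    have := congrArg Prod.snd (congrFun (congrFun haa t) β)
    simpa only [interference, hup Prod.snd] using this
  funext α
  exact Prod.ext (congrFun h1 α) (congrFun h2 α)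

theorem symVal_interference {n : ℕ} (σ : Fin K → D → E)
    (x : {k // k ≠ i} → Fin n → D → Fin q × Fin q) (t : Fin n) (β : E) :
    symVal (interference i σ x t β) =
      ∑ k : {k // k ≠ i}, ∑ α, if σ k α = β then symVal (x k t α) else 0 := by
  apply Complex.ext
  · simp only [symVal, interference, alignedSum, Complex.re_sum]
    push_cast
    refine Finset.sum_congr rfl fun k _ => Finset.sum_congr rfl fun α _ => ?_
    split_ifs <;> simp
  · simp only [symVal, interference, alignedSum, Complex.im_sum]
    push_cast
    refine Finset.sum_congr rfl fun k _ => Finset.sum_congr rfl fun α _ => ?_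
    split_ifs <;> simp

/-- The noiseless signal at receiver `i`, as a function of the symbols `x` of user `i` and of the
symbol sums `s` of the other users. -/
def cleanSignal {n F N : ℕ} [Fintype E] (h : Channel K) (c : ℝ) (v : D → Fin F → ℂ)
    (v' : E → Fin F → ℂ)
    (x : Fin n → D → Fin q × Fin q) (s : Fin n → E → Fin N × Fin N) : Signal n F :=
  fun t f => c * ∑ α, h i i f * v α f * symVal (x t α) + c * ∑ β, v' β f * symVal (s t β)

/-- The interference reaches receiver `i` only through the symbol sums. -/
theorem received_modulate {n F : ℕ} [Fintype E] (h : Channel K) (c : ℝ) (v : D → Fin F → ℂ)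
    (v' : E → Fin F → ℂ) (σ : Fin K → D → E)
    (hσ : ∀ k, i ≠ k → ∀ (α : D) (f : Fin F), h i k f * v α f = v' (σ k α) f)
    (x : Fin K → Fin n → D → Fin q × Fin q) (z : Signal n F) :
    received h i (fun k => modulate c v (x k)) z =
      cleanSignal i h c v v' (x i) (interference i σ fun k => x k) + z := by
  funext t f
  simp only [received, cleanSignal, Pi.add_apply]
  congr 1
  have hint : ∑ β, v' β f * symVal (interference i σ (fun k => x k) t β) =
      ∑ k : {k // k ≠ i}, ∑ α, h i k f * v α f * symVal (x k t α) := by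
    simp_rw [symVal_interference, Finset.mul_sum]
    rw [Finset.sum_comm]
    refine Finset.sum_congr rfl fun k _ => ?_
    rw [Finset.sum_comm]
    refine Finset.sum_congr rfl fun α _ => ?_
    rw [hσ k k.2.symm]
    simp
  rw [hint, ← mul_add, Fintype.sum_eq_add_sum_subtype_ne _ i, mul_add]
  simp only [modulate]
  congr 1
  · rw [Finset.mul_sum, Finset.mul_sum, Finset.mul_sum]
    refine Finset.sum_congr rfl fun α _ => ?_
    ring
  · rw [Finset.mul_sum]
    refine Finset.sum_congr rfl fun k _ => ?_
    rw [Finset.mul_sum, Finset.mul_sum, Finset.mul_sum]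
    refine Finset.sum_congr rfl fun α _ => ?_
    ring

end Interference

/-! ### Zero forcing and rounding -/

/-- Rounding of the coordinates of `A y / c` to the nearest Gaussian integers. -/
def roundedEstimate {n F : ℕ} {D : Type} (c : ℝ) (A : D → Fin F → ℂ) (y : Signal n F)
    (t : Fin n) (α : D) : ℤ × ℤ :=
  (round ((∑ f, A α f * y t f).re / c), round ((∑ f, A α f * y t f).im / c))

theorem measurable_roundedEstimate {n F : ℕ} {D : Type} (c : ℝ) (A : D → Fin F → ℂ) :
    Measurable (roundedEstimate (n := n) c A) := by
  unfold roundedEstimate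
  simp only [round_eq]
  refine measurable_pi_lambda _ fun t => measurable_pi_lambda _ fun α => ?_
  refine Measurable.prodMk (Measurable.floor ?_) (Measurable.floor ?_) <;>
  · have h1 : Measurable fun y : Signal n F => ∑ f, A α f * y t f := by fun_prop
    fun_prop

/-- The noise vectors that may lead to a wrong symbol estimate. -/
def noiseOutage {F : ℕ} {D : Type} (c : ℝ) (A : D → Fin F → ℂ) : Set (Fin F → ℂ) :=
  {ζ | ∃ α, c / 2 ≤ ‖∑ f, A α f * ζ f‖}

theorem round_natCast_add_div {c : ℝ} (hc : 0 < c) (m : ℕ) {e : ℝ} (he : |e| < c / 2) :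
    round ((c * m + e) / c) = (m : ℤ) := by
  have h1 : (c * m + e) / c = e / c + m := by field_simp; ring
  rw [h1, round_add_natCast]
  have h2 : round (e / c) = 0 := by
    rw [round_eq_zero_iff]
    rw [abs_lt] at he
    constructor
    · rw [le_div_iff₀ hc]; linarith
    · rw [div_lt_iff₀ hc]; linarith
  rw [h2, zero_add]

/-- The map `A` nulls the interference and leaves the scaled symbols plus noise, which is rounded off
unless there is an outage. -/
theorem roundedEstimate_eq {K n F q N : ℕ} {D E : Type} [Fintype D] [DecidableEq D] [Fintype E]
    (i : Fin K) (h : Channel K) {c : ℝ} (hc : 0 < c) (v : D → Fin F → ℂ) (v' : E → Fin F → ℂ)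
    (A : D → Fin F → ℂ)
    (hA : ∀ α α', ∑ f, A α f * (h i i f * v α' f) = if α = α' then 1 else 0)
    (hA' : ∀ α β, ∑ f, A α f * v' β f = 0) (x : Fin n → D → Fin q × Fin q)
    (s : Fin n → E → Fin N × Fin N) (z : Signal n F) (t : Fin n) (hz : z t ∉ noiseOutage c A) :
    roundedEstimate c A (cleanSignal i h c v v' x s + z) t =
      fun α => ((((x t α).1 : ℕ) : ℤ), (((x t α).2 : ℕ) : ℤ)) := by
  funext α
  have hsmall : ‖∑ f, A α f * z t f‖ < c / 2 := by
    by_contra hcon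
    exact hz ⟨α, not_lt.1 hcon⟩
  have hlin : ∑ f, A α f * (cleanSignal i h c v v' x s + z) t f =
      c * symVal (x t α) + ∑ f, A α f * z t f := by
    simp only [Pi.add_apply, cleanSignal, mul_add, Finset.sum_add_distrib]
    have e1 : ∑ f, A α f * (c * ∑ α', h i i f * v α' f * symVal (x t α')) =
        c * symVal (x t α) := by
      calc _ = ∑ α', (∑ f, A α f * (h i i f * v α' f)) * (c * symVal (x t α')) := by
            simp_rw [Finset.mul_sum, Finset.sum_mul]
            rw [Finset.sum_comm]
            refine Finset.sum_congr rfl fun α' _ => Finset.sum_congr rfl fun f _ => ?_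
            ring
        _ = _ := by simp [hA]
    have e2 : ∑ f, A α f * (c * ∑ β, v' β f * symVal (s t β)) = 0 := by
      calc _ = ∑ β, (∑ f, A α f * v' β f) * (c * symVal (s t β)) := by
            simp_rw [Finset.mul_sum, Finset.sum_mul]
            rw [Finset.sum_comm]
            refine Finset.sum_congr rfl fun β _ => Finset.sum_congr rfl fun f _ => ?_
            ring
        _ = 0 := by simp [hA']
    rw [e1, e2, add_zero]
  have hre := (Complex.abs_re_le_norm (∑ f, A α f * z t f)).trans_lt hsmall
  have him := (Complex.abs_im_le_norm (∑ f, A α f * z t f)).trans_lt hsmall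
  unfold roundedEstimate
  rw [hlin]
  simp only [Complex.add_re, Complex.add_im, Complex.re_ofReal_mul, Complex.im_ofReal_mul]
  exact Prod.ext (round_natCast_add_div hc _ hre) (round_natCast_add_div hc _ him)

/-- If the symbols are scaled up enough, outages are as rare as desired. -/
theorem exists_spacing {K F : ℕ} {D : Type} [Fintype D] (A : Fin K → D → Fin F → ℂ)
    (μ : Measure (Fin F → ℂ)) [IsProbabilityMeasure μ] {ε : ENNReal} (hε : 0 < ε) :
    ∃ c : ℝ, 0 < c ∧ ∀ i, μ (noiseOutage c (A i)) ≤ ε := by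
  let N : (Fin F → ℂ) → ℝ := fun ζ => ∑ i, ∑ α, ‖∑ f, A i α f * ζ f‖
  have hN : Measurable N := by fun_prop
  let s : ℕ → Set (Fin F → ℂ) := fun m => {ζ | ((m : ℝ) + 1) / 2 ≤ N ζ}
  have hanti : Antitone s := by
    intro m m' hmm ζ (hζ : ((m' : ℝ) + 1) / 2 ≤ N ζ)
    have : (m : ℝ) ≤ m' := by exact_mod_cast hmm
    change ((m : ℝ) + 1) / 2 ≤ N ζ
    linarith
  have hinter : ⋂ m, s m = ∅ := by
    rw [Set.eq_empty_iff_forall_notMem]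
    intro ζ hζ
    obtain ⟨m, hm⟩ := exists_nat_gt (2 * N ζ)
    have : ((m : ℝ) + 1) / 2 ≤ N ζ := Set.mem_iInter.1 hζ m
    linarith
  have hlim := tendsto_measure_iInter_atTop (μ := μ)
    (fun m => (measurableSet_le measurable_const hN).nullMeasurableSet) hanti
    ⟨0, measure_ne_top μ (s 0)⟩
  rw [hinter, measure_empty] at hlim
  obtain ⟨m, hm⟩ := ((tendsto_order.1 hlim).2 ε hε).exists
  refine ⟨m + 1, by positivity, fun i => (measure_mono ?_).trans hm.le⟩
  rintro ζ ⟨α, hα⟩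
  change ((m : ℝ) + 1) / 2 ≤ N ζ
  refine hα.trans ?_
  refine (Finset.single_le_sum (f := fun α => ‖∑ f, A i α f * ζ f‖)
    (fun _ _ => norm_nonneg _) (Finset.mem_univ α)).trans ?_
  exact Finset.single_le_sum (f := fun i => ∑ α, ‖∑ f, A i α f * ζ f‖)
    (fun _ _ => Finset.sum_nonneg fun _ _ => norm_nonneg _) (Finset.mem_univ i)

/-! ### The secret codebook at finite block length -/

/-- The performance of the aligned lattice scheme with Gilbert–Varshamov outer code and random
binning, at block length `n`: `a` messages and `b` randomization indices per user, `q ^ 2` symbols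
per beam, and up to `e` wrong estimates corrected. -/
theorem exists_codebook {K n F : ℕ} (hK : 2 ≤ K) (hn : 0 < n) (hF : 0 < F) (h : Channel K)
    {D E : Type} [Fintype D] [DecidableEq D] [Fintype E] [DecidableEq E]
    (v : D → Fin F → ℂ) (v' : E → Fin F → ℂ) (σ : Fin K → Fin K → D → E)
    (A : Fin K → D → Fin F → ℂ) (hσ : ∀ i k, Function.Injective (σ i k))
    (hshift : ∀ i k, i ≠ k → ∀ (α : D) (f : Fin F), h i k f * v α f = v' (σ i k α) f)
    (hA : ∀ i α α', ∑ f, A i α f * (h i i f * v α' f) = if α = α' then 1 else 0)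
    (hA' : ∀ i α β, ∑ f, A i α f * v' β f = 0)
    {q a b e : ℕ} (hq : 0 < q) (ha : 0 < a) (hb : 0 < b) {c : ℝ} (hc : 0 < c) {p : ENNReal}
    (hp : ∀ i, Measure.pi (fun _ : Fin F => complexGaussian) (noiseOutage c (A i)) ≤ p)
    (hp1 : p ≠ ⊤)
    (hcode : a * b * (2 ^ n * ((q * q) ^ Fintype.card D) ^ (2 * e)) ≤
      ((q * q) ^ Fintype.card D) ^ n) :
    ∃ C : SecretCodebook K n F (fun _ => a),
      C.PowerConstraint ((2 * c * ∑ α, ∑ f, ‖v α f‖) ^ 2 * q ^ 2) ∧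
      (∀ k, C.errorProb h k ≤ (2 ^ n * p ^ (e + 1)).toReal) ∧
      ∀ i : Fin K, ∀ S : Finset (Fin K), i ∉ S →
        1 - 6 * √(K * ((((K * Fintype.card D * q + 1 : ℕ) : ℝ) ^ 2) ^ (Fintype.card E * n) *
          (((b : ℝ)⁻¹) ^ (K - 1) + 2 ^ (K - 1) / (b * (a * b))))) ≤ C.equivocation h S i := by
  classical
  have : NeZero b := ⟨hb.ne'⟩
  have : NeZero a := ⟨ha.ne'⟩
  have : NeZero q := ⟨hq.ne'⟩
  obtain ⟨cw, hcw⟩ := exists_code (n := n) (U := Fin a × Fin b) (β := D → Fin q × Fin q) (2 * e)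
    (by simpa using hcode)
  have hcwinj : Function.Injective cw := by
    intro u u' huu
    by_contra hne
    have := hcw u u' hne
    rw [huu, hammingDist_self] at this
    omega
  -- binning that hides the codewords from all receivers
  let g : (i : Fin K) → ({k // k ≠ i} → Fin a × Fin b) → (Fin n → E →
      Fin (K * Fintype.card D * q + 1) × Fin (K * Fintype.card D * q + 1)) :=
    fun i u => interference i (σ i) fun k => cw (u k)
  obtain ⟨π, hπ⟩ := exists_binning hK g (by
    intro i u j x x' hxx
    apply hcwinj
    apply interference_update_injective i (σ i) (hσ i) (fun k => cw (u k)) j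
    have hup : ∀ x, (fun k => cw (Function.update u j x k)) =
        Function.update (fun k => cw (u k)) j (cw x) := by
      intro x
      funext k
      by_cases hk : k = j
      · subst hk; simp
      · simp [Function.update_of_ne hk]
    simpa only [g, hup] using hxx)
  -- decoding of the integer symbols
  let lift : (D → Fin q × Fin q) → D → ℤ × ℤ := fun x α =>
    ((((x α).1 : ℕ) : ℤ), (((x α).2 : ℕ) : ℤ))
  have hlift : Function.Injective lift := by
    intro x x' hxx
    funext α
    have := congrFun hxx α
    simp only [lift, Prod.mk.injEq, Nat.cast_inj] at this
    exact Prod.ext (Fin.ext this.1) (Fin.ext this.2)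
  obtain ⟨dec0, hdec0⟩ := exists_decoder (r := 2 * e) (fun u t => lift (cw u t)) (by
    intro u u' huu
    rw [hammingDist_comp (fun _ => lift) (fun _ => hlift)]
    exact hcw u u' huu)
  let dec : Fin K → Signal n F → Fin a := fun i y =>
    ((π i).symm (dec0 (roundedEstimate c (A i) y))).1
  have hdec : ∀ i, Measurable (dec i) := fun i =>
    (measurable_of_countable fun y => ((π i).symm (dec0 y)).1).comp
      (measurable_roundedEstimate c (A i))
  let X : Fin a × Fin b → Signal n F := fun u => modulate c v (cw u)
  have hrec : ∀ (i : Fin K) (w : Fin K → Fin a) (r : Fin K → Fin b) (z : Signal n F),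
      received h i (fun k => X (π k (w k, r k))) z =
      cleanSignal i h c v v' (cw (π i (w i, r i))) (g i fun k => π k (w k, r k)) + z :=
    fun i w r z => received_modulate i h c v v' (σ i) (hshift i) (fun k => cw (π k (w k, r k))) z
  refine ⟨binnedCodebook X π dec hdec, ?_, ?_, ?_⟩
  · intro k w
    have hbound : ∀ u, (1 / ((n : ℝ) * F)) * ∑ f, ∑ t, ‖X u t f‖ ^ 2 ≤
        (2 * c * ∑ α, ∑ f, ‖v α f‖) ^ 2 * q ^ 2 := by
      intro u
      have hn' : (0 : ℝ) < n := by exact_mod_cast hn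
      have hF' : (0 : ℝ) < F := by exact_mod_cast hF
      rw [one_div, inv_mul_le_iff₀ (by positivity)]
      refine (Finset.sum_le_sum fun f _ => Finset.sum_le_sum fun t _ =>
        norm_modulate_sq_le hc.le v (cw u) t f).trans (le_of_eq ?_)
      simp only [Finset.sum_const, Finset.card_univ, Fintype.card_fin, nsmul_eq_mul]
      ring
    have hset : MeasurableSet {x : Signal n F | (1 / ((n : ℝ) * F)) * ∑ f, ∑ t, ‖x t f‖ ^ 2 ≤
        (2 * c * ∑ α, ∑ f, ‖v α f‖) ^ 2 * q ^ 2} :=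
      measurableSet_le (by fun_prop) measurable_const
    exact (ae_map_iff (measurable_of_finite _).aemeasurable hset).2
      (Eventually.of_forall fun r => hbound _)
  · intro k
    have hcond : ∀ w : Fin K → Fin a, ((binnedCodebook X π dec hdec).outputLaw h k w).real
        {y | dec k y ≠ w k} ≤ (2 ^ n * p ^ (e + 1)).toReal := by
      intro w
      have hset : MeasurableSet {y | dec k y ≠ w k} :=
        (hdec k (measurableSet_singleton (w k))).compl
      rw [binnedCodebook_outputLaw X π dec hdec h k w hset, div_le_iff₀ (by positivity)]
      have hr : ∀ r : Fin K → Fin b, (noise n F).real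
          {z | received h k (fun j => X (π j (w j, r j))) z ∈ {y | dec k y ≠ w k}} ≤
          (2 ^ n * p ^ (e + 1)).toReal := by
        intro r
        have hsub : {z | received h k (fun j => X (π j (w j, r j))) z ∈ {y | dec k y ≠ w k}} ⊆
            {z : Signal n F | e <
              (Finset.univ.filter fun t => z t ∈ noiseOutage c (A k)).card} := by
          intro z hz
          by_contra hcon
          apply hz
          have hle : (Finset.univ.filter fun t => z t ∈ noiseOutage c (A k)).card ≤ e :=
            not_lt.1 hcon
          have hdist : hammingDist (fun t => lift (cw (π k (w k, r k)) t))
              (roundedEstimate c (A k) (received h k (fun j => X (π j (w j, r j))) z)) ≤ e := by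
            refine le_trans (Finset.card_le_card ?_) hle
            intro t ht
            simp only [Finset.mem_filter, Finset.mem_univ, true_and] at ht ⊢
            by_contra hzt
            apply ht
            rw [hrec, roundedEstimate_eq k h hc v v' (A k) (hA k) (hA' k) _ _ z t hzt]
          have := hdec0 _ _ (Nat.mul_le_mul_left 2 hdist)
          simp only [dec]
          rw [this, Equiv.symm_apply_apply]
        rw [measureReal_def]
        refine ENNReal.toReal_mono (by finiteness) ((measure_mono hsub).trans ?_)
        have htail := measure_pi_card_lt_le (n := n)
          (Measure.pi fun _ : Fin F => complexGaussian) (noiseOutage c (A k)) e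
        refine le_trans htail ?_
        gcongr
        exact hp k
      refine (Finset.sum_le_sum fun r _ => hr r).trans (le_of_eq ?_)
      simp [mul_comm]
    unfold SecretCodebook.errorProb
    have haR : (0 : ℝ) < a := by exact_mod_cast ha
    rw [one_div, inv_mul_le_iff₀ (Finset.prod_pos fun _ _ => haR)]
    refine (Finset.sum_le_sum fun w _ => hcond w).trans (le_of_eq ?_)
    simp
  · intro i S hi
    set δ := √(K * ((((K * Fintype.card D * q + 1 : ℕ) : ℝ) ^ 2) ^ (Fintype.card E * n) *
          (((b : ℝ)⁻¹) ^ (K - 1) + 2 ^ (K - 1) / (b * (a * b))))) with hδ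
    let Φ : Set (Signal n F) → Fin a × Fin b → (Fin n → E →
      Fin (K * Fintype.card D * q + 1) × Fin (K * Fintype.card D * q + 1)) → ℝ :=
      fun T u s => (noise n F).real {z | cleanSignal i h c v v' (cw u) s + z ∈ T}
    refine equivocation_ge (binnedCodebook X π dec hdec) h i (fun _ => ha)
      (fun w T => (∑ r : Fin b, ∑ s, uniformLaw (g i) s * Φ T (π i (w, r)) s) /
        Fintype.card (Fin b))
      (fun w => leakage (g i) (fun k => π k) (fun k => w k)) (Real.sqrt_nonneg _) ?_ ?_ hi
    · intro w T hT
      rw [binnedCodebook_outputLaw X π dec hdec h i w hT]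
      simp_rw [hrec]
      have := abs_sub_le_leakage i (g i) π w (Φ T) (fun _ _ => measureReal_nonneg)
        (fun _ _ => measureReal_le_one)
      rwa [Fintype.card_fin] at this ⊢
    · have hJ : (0 : ℝ) < Fintype.card ({k // k ≠ i} → Fin a) := by
        exact_mod_cast Fintype.card_pos
      have h1 := Real.le_sqrt_of_sq_le (hπ i)
      have h2 : (K : ℝ) * (Fintype.card (Fin n → E → Fin (K * Fintype.card D * q + 1) ×
          Fin (K * Fintype.card D * q + 1)) *
        (((Fintype.card (Fin b) : ℝ)⁻¹) ^ (K - 1) +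
          2 ^ (K - 1) / (Fintype.card (Fin b) * Fintype.card (Fin a × Fin b)))) =
          K * ((((K * Fintype.card D * q + 1 : ℕ) : ℝ) ^ 2) ^ (Fintype.card E * n) *
          (((b : ℝ)⁻¹) ^ (K - 1) + 2 ^ (K - 1) / (b * (a * b)))) := by
        simp only [Fintype.card_fun, Fintype.card_prod, Fintype.card_fin]
        push_cast
        rw [pow_mul, sq]
      rw [h2, ← hδ, div_le_iff₀ hJ] at h1
      rw [sum_comp_restrict_ne i (fun w => leakage (g i) (fun k => π k) w)]
      refine (mul_le_mul_of_nonneg_left h1 (by positivity)).trans (le_of_eq ?_)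
      have h3 : (Fintype.card (Fin K → Fin a) : ℝ) =
          Fintype.card (Fin a) * Fintype.card ({k // k ≠ i} → Fin a) := by
        rw [Fintype.card_congr (Equiv.funSplitAt i (Fin a)), Fintype.card_prod]
        push_cast; rfl
      have h4 : ∏ _k : Fin K, (a : ℝ) = Fintype.card (Fin K → Fin a) := by simp
      rw [h4, h3]
      ring

/-! ### Achievable rates at fixed power -/

theorem natCast_interference_size_le {N s κ : ℕ} (hκ : N + 1 ≤ 2 ^ κ) :
    ((N * 2 ^ s + 1 : ℕ) : ℝ) ≤ 2 ^ (s + κ) := by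
  have h1 : N * 2 ^ s + 1 ≤ 2 ^ (s + κ) := by
    calc N * 2 ^ s + 1 ≤ (N + 1) * 2 ^ s := by
          have := Nat.one_le_two_pow (n := s)
          nlinarith
      _ ≤ 2 ^ κ * 2 ^ s := Nat.mul_le_mul_right _ hκ
      _ = 2 ^ (s + κ) := by rw [← pow_add, add_comm]
  exact_mod_cast h1

theorem two_pow_mul_inv_le {x y ν : ℕ} (h : x + ν ≤ y) :
    (2 : ℝ) ^ x * (2 ^ y)⁻¹ ≤ (1 / 2) ^ ν := by
  rw [one_div, inv_pow, ← div_eq_mul_inv, div_le_iff₀ (by positivity), ← div_eq_inv_mul,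
    le_div_iff₀ (by positivity), ← pow_add]
  exact pow_le_pow_right₀ (by norm_num) h

/-- The codebooks at block lengths `L * ν`, `ν → ∞`, with `4 ^ s` symbols per beam and with
`2 ^ (β * ν)` randomization indices achieve the rate `R` with perfect secrecy. The first condition
on the parameters leaves room for the minimum distance of the code, the other two make the
randomization sufficient to cover the symbol sums seen by a receiver. -/
theorem achievable_of_hasAlignment {K F : ℕ} (hK : 2 ≤ K) (hF : 0 < F) (h : Channel K)
    {D E : Type} [Fintype D] [DecidableEq D] [Fintype E] [DecidableEq E]
    (hal : HasAlignment h D E F) {L κ : ℕ} (hL : 0 < L) (hκ : K * Fintype.card D + 1 ≤ 2 ^ κ) :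
    ∃ V : ℝ, 0 < V ∧ ∀ (s R β : ℕ) (ρ : ℝ), V * 4 ^ s ≤ ρ →
      L * F * R + β + L + 2 * (2 * s * Fintype.card D) ≤ L * (2 * s * Fintype.card D) →
      2 * Fintype.card E * L * (s + κ) + 1 ≤ (K - 1) * β →
      2 * Fintype.card E * L * (s + κ) + 1 ≤ L * F * R + 2 * β →
      Achievable h ρ (fun _ => R) 1 := by
  obtain ⟨v, v', σ, A, hσ, hshift, hA, hA'⟩ := hal
  obtain ⟨c, hc, hp⟩ := exists_spacing A (Measure.pi (fun _ : Fin F => complexGaussian))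
    (ε := (2 ^ (L + 1))⁻¹) (by simp)
  -- with outages of probability `2 ^ -(L + 1)`, more than `ν` of them among `L * ν` slots are rare
  set V0 := (2 * c * ∑ α, ∑ f, ‖v α f‖) ^ 2 with hV0
  refine ⟨V0 + 1, by positivity, ?_⟩
  intro s R β ρ hρ hroom hcov1 hcov2 ε hε
  set Γ : ℝ := K * (1 + 2 ^ (K - 1)) with hΓ
  have hK0 : (0 : ℝ) < K := by exact_mod_cast (by omega : 0 < K)
  have hΓ0 : 0 < Γ := by positivity
  obtain ⟨ν0, hν0⟩ := exists_pow_lt_of_lt_one (y := (1 / 2 : ℝ))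
    (lt_min hε (show 0 < (ε / 6) ^ 2 / Γ by positivity)) (by norm_num)
  set ν := ν0 + 1 with hνdef
  have hν : (1 / 2 : ℝ) ^ ν < min ε ((ε / 6) ^ 2 / Γ) :=
    (pow_le_pow_of_le_one (by norm_num) (by norm_num) (by omega)).trans_lt hν0
  have hνpos : 0 < ν := by omega
  set n := L * ν with hn
  have hn0 : 0 < n := Nat.mul_pos hL hνpos
  set d := Fintype.card D with hd
  set e := Fintype.card E with he
  obtain ⟨C, hpow, herr, hsec⟩ := exists_codebook hK hn0 hF h v v' σ A hσ hshift hA hA'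
    (q := 2 ^ s) (a := 2 ^ (n * F * R)) (b := 2 ^ (β * ν)) (e := ν) (by positivity) (by positivity)
    (by positivity) hc hp (by simp) (by
      rw [← hd, ← pow_add 2 s s, ← pow_mul, ← pow_mul, ← pow_mul, ← pow_mul, ← pow_add, ← pow_add,
        ← pow_add]
      refine Nat.pow_le_pow_right (by norm_num) ?_
      have := Nat.mul_le_mul_right ν hroom
      rw [hn]
      calc _ = (L * F * R + β + L + 2 * (2 * s * d)) * ν := by ring
        _ ≤ L * (2 * s * d) * ν := this
        _ = _ := by ring)
  refine ⟨n, F, _, C, hn0, hF, ?_, ?_, ?_, ?_⟩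
  · intro k w
    filter_upwards [hpow k w] with x hx
    refine hx.trans (le_trans ?_ hρ)
    have h4 : (((2 ^ s : ℕ) : ℝ)) ^ 2 = 4 ^ s := by
      push_cast
      rw [← pow_mul, mul_comm, pow_mul]
      norm_num
    rw [h4]
    have : (0 : ℝ) < 4 ^ s := by positivity
    nlinarith
  · intro k
    have hn' : (n : ℝ) ≠ 0 := by exact_mod_cast hn0.ne'
    have hF' : (F : ℝ) ≠ 0 := by exact_mod_cast hF.ne'
    push_cast
    rw [Real.logb_pow, Real.logb_self_eq_one (by norm_num)]
    push_cast
    field_simp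
  · intro k
    refine (herr k).trans (le_trans ?_ (hν.le.trans (min_le_left _ _)))
    have h1 : (2 ^ n * ((2 ^ (L + 1))⁻¹ : ENNReal) ^ (ν + 1)).toReal =
        2 ^ n * (2 ^ ((L + 1) * (ν + 1)))⁻¹ := by
      rw [ENNReal.toReal_mul, ENNReal.toReal_pow, ENNReal.toReal_pow, ENNReal.toReal_inv,
        ENNReal.toReal_pow, ENNReal.toReal_ofNat, inv_pow, ← pow_mul]
    rw [h1]
    refine two_pow_mul_inv_le ?_
    rw [hn]
    nlinarith
  · intro i S hi
    refine le_trans ?_ (hsec i S hi)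
    have hZ : (((K * d * 2 ^ s + 1 : ℕ) : ℝ) ^ 2) ^ (e * n) ≤ 2 ^ (2 * e * L * (s + κ) * ν) := by
      calc _ ≤ (((2 : ℝ) ^ (s + κ)) ^ 2) ^ (e * n) := by
            have := natCast_interference_size_le (N := K * d) (s := s) hκ
            gcongr
        _ = _ := by
            rw [← pow_mul, ← pow_mul, hn]
            congr 1
            ring
    have hfirst : (2 : ℝ) ^ (2 * e * L * (s + κ) * ν) *
        ((((2 ^ (β * ν) : ℕ) : ℝ)⁻¹) ^ (K - 1)) ≤ (1 / 2) ^ ν := by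
      push_cast
      rw [inv_pow, ← pow_mul]
      refine two_pow_mul_inv_le ?_
      calc _ = (2 * e * L * (s + κ) + 1) * ν := by ring
        _ ≤ ((K - 1) * β) * ν := Nat.mul_le_mul_right _ hcov1
        _ = _ := by ring
    have hsecond : (2 : ℝ) ^ (2 * e * L * (s + κ) * ν) * (2 ^ (K - 1) / (((2 ^ (β * ν) : ℕ) : ℝ) *
        (((2 ^ (n * F * R) : ℕ) : ℝ) * ((2 ^ (β * ν) : ℕ) : ℝ)))) ≤
        2 ^ (K - 1) * (1 / 2) ^ ν := by
      push_cast
      rw [← pow_add, ← pow_add, div_eq_mul_inv, mul_left_comm]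
      refine mul_le_mul_of_nonneg_left (two_pow_mul_inv_le ?_) (by positivity)
      calc _ = (2 * e * L * (s + κ) + 1) * ν := by ring
        _ ≤ (L * F * R + 2 * β) * ν := Nat.mul_le_mul_right _ hcov2
        _ = _ := by rw [hn]; ring
    have htot : (K : ℝ) * ((((K * d * 2 ^ s + 1 : ℕ) : ℝ) ^ 2) ^ (e * n) *
          ((((2 ^ (β * ν) : ℕ) : ℝ)⁻¹) ^ (K - 1) + 2 ^ (K - 1) / (((2 ^ (β * ν) : ℕ) : ℝ) *
            (((2 ^ (n * F * R) : ℕ) : ℝ) * ((2 ^ (β * ν) : ℕ) : ℝ))))) ≤ (ε / 6) ^ 2 := by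
      calc _ ≤ (K : ℝ) * (2 ^ (2 * e * L * (s + κ) * ν) *
          ((((2 ^ (β * ν) : ℕ) : ℝ)⁻¹) ^ (K - 1) + 2 ^ (K - 1) / (((2 ^ (β * ν) : ℕ) : ℝ) *
            (((2 ^ (n * F * R) : ℕ) : ℝ) * ((2 ^ (β * ν) : ℕ) : ℝ))))) := by gcongr
        _ ≤ K * ((1 / 2) ^ ν + 2 ^ (K - 1) * (1 / 2) ^ ν) := by
            rw [mul_add]
            gcongr
        _ = Γ * (1 / 2) ^ ν := by rw [hΓ]; ring
        _ ≤ Γ * ((ε / 6) ^ 2 / Γ) := by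
            gcongr
            exact hν.le.trans (min_le_right _ _)
        _ = _ := by field_simp
    have hsqrt := (Real.sqrt_le_sqrt htot).trans_eq (Real.sqrt_sq (by positivity))
    linarith

/-- Rate zero is achieved by sending nothing. -/
theorem achievable_zero {K : ℕ} (h : Channel K) {ρ : ℝ} (hρ : 0 < ρ) :
    Achievable h ρ (fun _ => 0) 1 := by
  intro ε hε
  let C : SecretCodebook K 1 1 (fun _ => 1) :=
    { enc := fun _ _ => Measure.dirac 0
      enc_prob := fun _ _ => inferInstance
      dec := fun _ _ => 0
      dec_measurable := fun _ => measurable_const }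
  refine ⟨1, 1, fun _ => 1, C, one_pos, one_pos, ?_, by simp, ?_, ?_⟩
  · intro k w
    have hset : MeasurableSet {x : Signal 1 1 | (1 / (((1 : ℕ) : ℝ) * ((1 : ℕ) : ℝ))) *
        ∑ f, ∑ t, ‖x t f‖ ^ 2 ≤ ρ} :=
      measurableSet_le (by fun_prop) measurable_const
    exact (ae_dirac_iff hset).2 (by simpa using hρ.le)
  · intro k
    have h0 : ∀ w : Fin K → Fin 1, {y | C.dec k y ≠ w k} = ∅ := by
      intro w
      ext y
      simp [Subsingleton.elim (C.dec k y) (w k)]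
    unfold SecretCodebook.errorProb
    simp only [h0, measureReal_empty, Finset.sum_const_zero, mul_zero]
    exact hε.le
  · intro i S hi
    have := equivocation_ge C h i (fun _ => one_pos) (fun w T => (C.outputLaw h i 0).real T)
      (fun _ => 0) le_rfl (by
        intro w T _
        rw [Subsingleton.elim w 0]
        simp) (by simp) hi
    linarith

/-! ### Degrees of freedom -/

/-- As the number of powers in the beams grows, the desired beams and the interference fill half of
the signal space each. The outer code of minimum distance proportional to `1 / m` costs nothing in
the limit either. -/
theorem exists_beam_number {K N : ℕ} (hK : 2 ≤ K) {η : ℝ} (hη : η < ((K : ℝ) - 2) / (2 * K - 2)) :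
    ∃ m : ℕ, 0 < m ∧
      η * (m * ((m : ℝ) ^ N + (m + 1) ^ N)) ≤ m ^ N * (m - 2) - (m + 1) ^ N * m / (K - 1) ∧
      η * (m * ((m : ℝ) ^ N + (m + 1) ^ N)) ≤ 2 * (m ^ N * (m - 2)) - (m + 1) ^ N * m := by
  have hK2 : (2 : ℝ) ≤ K := by exact_mod_cast hK
  have hinv : Tendsto (fun m : ℕ => 1 / (m : ℝ)) atTop (𝓝 0) := tendsto_one_div_atTop_nhds_zero_nat
  -- `r m` is the ratio of the numbers of interfering and desired beams
  let r : ℕ → ℝ := fun m => (1 + 1 / (m : ℝ)) ^ N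
  have hr : Tendsto r atTop (𝓝 1) := by
    have := (tendsto_const_nhds (x := (1 : ℝ)).add hinv).pow N
    rwa [add_zero, one_pow] at this
  have hη2 : η * 2 < 1 - 1 / (K - 1) := by
    have h1 : ((K : ℝ) - 2) / (2 * K - 2) = (1 - 1 / (K - 1)) / 2 := by
      have : (K : ℝ) - 1 ≠ 0 := by linarith
      have h2 : 2 * (K : ℝ) - 2 ≠ 0 := by linarith
      field_simp
      ring
    rw [h1] at hη
    linarith
  have hK1 : (0 : ℝ) ≤ 1 / (K - 1) := by
    apply one_div_nonneg.2; linarith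
  have hl : Tendsto (fun m => η * (1 + r m)) atTop (𝓝 (η * (1 + 1))) :=
    (hr.const_add 1).const_mul η
  have hu1 : Tendsto (fun m : ℕ => (1 - 2 * (1 / (m : ℝ))) - r m * (1 / (K - 1))) atTop
      (𝓝 ((1 - 2 * 0) - 1 * (1 / ((K : ℝ) - 1)))) :=
    ((hinv.const_mul 2).const_sub 1).sub (hr.mul_const _)
  have hu2 : Tendsto (fun m : ℕ => 2 * (1 - 2 * (1 / (m : ℝ))) - r m) atTop
      (𝓝 (2 * (1 - 2 * 0) - 1)) :=
    (((hinv.const_mul 2).const_sub 1).const_mul 2).sub hr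
  have e1 := hl.eventually_lt hu1 (by linarith)
  have e2 := hl.eventually_lt hu2 (by linarith)
  obtain ⟨m, h1, h2, hm⟩ := (e1.and (e2.and (eventually_gt_atTop 0))).exists
  have hm0 : (0 : ℝ) < m := by exact_mod_cast hm
  have hrm : ((m : ℝ) + 1) ^ N = m ^ N * r m := by
    simp only [r]
    rw [← mul_pow]
    congr 1
    field_simp
  have hmul : (0 : ℝ) ≤ m ^ N * m := by positivity
  refine ⟨m, hm, ?_, ?_⟩
  · have := mul_le_mul_of_nonneg_left h1.le hmul
    rw [hrm]
    calc _ = (m : ℝ) ^ N * m * (η * (1 + r m)) := by ring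
      _ ≤ _ := this
      _ = _ := by field_simp
  · have := mul_le_mul_of_nonneg_left h2.le hmul
    rw [hrm]
    calc _ = (m : ℝ) ^ N * m * (η * (1 + r m)) := by ring
      _ ≤ _ := this
      _ = _ := by field_simp

theorem exists_symbol_bits {V ρ : ℝ} (hV : 0 < V) (hρ : V ≤ ρ) :
    ∃ s : ℕ, V * 4 ^ s ≤ ρ ∧ Real.logb 2 ρ ≤ 2 * s + (Real.logb 2 V + 2) := by
  have h1 : (1 : ℝ) ≤ ρ / V := (one_le_div hV).2 hρ
  obtain ⟨s, hs1, hs2⟩ := exists_nat_pow_near h1 (by norm_num : (1 : ℝ) < 4)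
  refine ⟨s, ?_, ?_⟩
  · rw [le_div_iff₀ hV] at hs1
    linarith
  · rw [div_lt_iff₀ hV] at hs2
    have hρ0 : 0 < ρ := hV.trans_le hρ
    have h2 := (Real.logb_le_logb_of_le (b := 2) (by norm_num) hρ0 hs2.le)
    rw [Real.logb_mul (by positivity) hV.ne', show (4 : ℝ) = 2 ^ 2 by norm_num, ← pow_mul,
      Real.logb_pow, Real.logb_self_eq_one (by norm_num)] at h2
    push_cast at h2
    linarith

/-- All integral rates below `η log ρ`, up to a constant, are achievable. The outer code has length
`m * ν` and corrects `ν` errors, where `m` is the number of powers in the beams. -/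
theorem exists_const_achievable {K : ℕ} (hK : 2 ≤ K) (h : Channel K)
    (hal : ∀ m, HasAlignment h (CrossPair K → Fin m) (CrossPair K → Fin (m + 1))
      (Fintype.card ((CrossPair K → Fin m) ⊕ (CrossPair K → Fin (m + 1)))))
    {η : ℝ} (hη : η < ((K : ℝ) - 2) / (2 * K - 2)) :
    ∃ C : ℝ, ∀ ρ : ℝ, 1 ≤ ρ → ∀ R : ℕ, (R : ℝ) ≤ η * Real.logb 2 ρ - C →
      Achievable h ρ (fun _ => R) 1 := by
  rcases le_or_gt η 0 with hη0 | hη0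
  · refine ⟨1, fun ρ hρ R hR => ?_⟩
    have h1 : 0 ≤ Real.logb 2 ρ := Real.logb_nonneg (by norm_num) hρ
    have h2 : (0 : ℝ) ≤ R := Nat.cast_nonneg R
    nlinarith
  obtain ⟨m, hm, hm1, hm2⟩ := exists_beam_number (N := Fintype.card (CrossPair K)) hK hη
  set d := Fintype.card (CrossPair K → Fin m) with hd
  set e := Fintype.card (CrossPair K → Fin (m + 1)) with he
  have hdR : (d : ℝ) = (m : ℝ) ^ Fintype.card (CrossPair K) := by
    rw [hd, Fintype.card_fun, Fintype.card_fin]; push_cast; rfl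
  have heR : (e : ℝ) = ((m : ℝ) + 1) ^ Fintype.card (CrossPair K) := by
    rw [he, Fintype.card_fun, Fintype.card_fin]; push_cast; rfl
  set F := Fintype.card ((CrossPair K → Fin m) ⊕ (CrossPair K → Fin (m + 1))) with hF
  have hFR : (F : ℝ) = d + e := by rw [hF, Fintype.card_sum]; push_cast; rfl
  have hd0 : 0 < d := by
    rw [hd, Fintype.card_fun, Fintype.card_fin]; positivity
  have hF0 : 0 < F := by
    rw [hF, Fintype.card_sum]; omega
  rw [← hdR, ← heR, ← hFR] at hm1 hm2
  obtain ⟨κ, hκ⟩ : ∃ κ : ℕ, K * d + 1 ≤ 2 ^ κ := ⟨K * d + 1, Nat.lt_two_pow_self.le⟩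
  obtain ⟨V, hV, hach⟩ := achievable_of_hasAlignment hK hF0 h (hal m) hm hκ
  -- the constant pays for rounding `s`, for the factor `V`, and for the carries `κ`
  refine ⟨η * (|Real.logb 2 V| + 2) + (2 * e * κ + 3), fun ρ hρ R hR => ?_⟩
  have hR0 : (0 : ℝ) ≤ R := Nat.cast_nonneg R
  have heκ : (0 : ℝ) ≤ 2 * e * κ := by positivity
  have hρ0 : 0 < ρ := by linarith
  have habs := le_abs_self (Real.logb 2 V)
  have hlogV : Real.logb 2 V ≤ Real.logb 2 ρ := by
    have h1 : η * (|Real.logb 2 V| + 2) ≤ η * Real.logb 2 ρ := by linarith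
    have := le_of_mul_le_mul_left h1 hη0
    linarith
  obtain ⟨s, hs1, hs2⟩ := exists_symbol_bits hV ((Real.logb_le_logb (by norm_num) hV hρ0).1 hlogV)
  have hRs : (R : ℝ) ≤ 2 * η * s - (2 * e * κ + 3) := by
    have h1 : η * Real.logb 2 ρ ≤ η * (2 * s + (|Real.logb 2 V| + 2)) :=
      mul_le_mul_of_nonneg_left (by linarith) hη0.le
    linarith
  have hm0 : (1 : ℝ) ≤ m := by exact_mod_cast hm
  have hF1 : (1 : ℝ) ≤ F := by exact_mod_cast hF0
  have hK1 : (1 : ℝ) ≤ (K : ℝ) - 1 := by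
    have : (2 : ℝ) ≤ K := by exact_mod_cast hK
    linarith
  have hs0 : (0 : ℝ) ≤ s := Nat.cast_nonneg s
  -- the loss of `2 e κ + 3` bits in the rate, counted per `m` time slots and `F` frequency slots
  have hloss : (m : ℝ) * F * R + m * (2 * e * κ + 3) ≤ 2 * s * (η * (m * F)) := by
    have h1 := mul_le_mul_of_nonneg_left hRs (by positivity : (0 : ℝ) ≤ m * F)
    have h2 : (m : ℝ) * (2 * e * κ + 3) * 1 ≤ m * (2 * e * κ + 3) * F :=
      mul_le_mul_of_nonneg_left hF1 (by positivity)
    linarith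
  have hm1s : 2 * s * (η * (m * F)) ≤ 2 * s * (d * (m - 2)) - 2 * s * (e * m / (K - 1)) := by
    have := mul_le_mul_of_nonneg_left hm1 (by positivity : (0 : ℝ) ≤ 2 * s)
    linarith
  have hm2s : 2 * s * (η * (m * F)) ≤ 4 * s * (d * (m - 2)) - 2 * s * (e * m) := by
    have := mul_le_mul_of_nonneg_left hm2 (by positivity : (0 : ℝ) ≤ 2 * s)
    linarith
  have hfrac : (0 : ℝ) ≤ 2 * s * (e * m / (K - 1)) := by positivity
  have hmeκ : (0 : ℝ) ≤ m * (2 * e * κ) := by positivity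
  have hroomR : (m : ℝ) * F * R + m + 2 * (2 * s * d) ≤ m * (2 * s * d) := by linarith
  have hroom : m * F * R + m + 2 * (2 * s * d) ≤ m * (2 * s * d) := by exact_mod_cast hroomR
  obtain ⟨β, hβ⟩ := Nat.exists_eq_add_of_le hroom
  have hβR : (m : ℝ) * (2 * s * d) = m * F * R + m + 2 * (2 * s * d) + β := by exact_mod_cast hβ
  refine hach s R β ρ hs1 (by rw [← hd]; omega) ?_ ?_
  · rw [← he]
    have hKc : ((K - 1 : ℕ) : ℝ) = (K : ℝ) - 1 := by
      rw [Nat.cast_sub (by omega)]; simp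
    have hcov : 2 * (e : ℝ) * m * (s + κ) + 1 ≤ (K - 1) * β := by
      have h1 : 2 * s * (e * m / (K - 1)) + m * (2 * e * κ + 2) ≤ (β : ℝ) := by linarith
      have h2 : ((K : ℝ) - 1) * (2 * s * (e * m / (K - 1))) = 2 * s * (e * m) := by
        field_simp
      have h3 := mul_le_mul_of_nonneg_left h1 (by linarith : (0 : ℝ) ≤ K - 1)
      have h4 : 1 * ((m : ℝ) * (2 * e * κ + 2)) ≤ (K - 1) * (m * (2 * e * κ + 2)) :=
        mul_le_mul_of_nonneg_right hK1 (by positivity)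
      linarith
    rw [← hKc] at hcov
    exact_mod_cast hcov
  · rw [← he]
    have hcov : 2 * (e : ℝ) * m * (s + κ) + 1 ≤ m * F * R + 2 * β := by linarith
    exact_mod_cast hcov

theorem secureDoFAchievable_of_hasAlignment {K : ℕ} (hK : 2 ≤ K) (h : Channel K)
    (hal : ∀ m, HasAlignment h (CrossPair K → Fin m) (CrossPair K → Fin (m + 1))
      (Fintype.card ((CrossPair K → Fin m) ⊕ (CrossPair K → Fin (m + 1))))) :
    SecureDoFAchievable h (((K : ℝ) - 2) / (2 * (K : ℝ) - 2)) := by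
  set η := ((K : ℝ) - 2) / (2 * (K : ℝ) - 2) with hη
  have hK2 : (2 : ℝ) ≤ K := by exact_mod_cast hK
  have hη0 : 0 ≤ η := div_nonneg (by linarith) (by linarith)
  -- the largest achievable integral rate that does not exceed `η log ρ`
  -- (for `ρ < 1` the set may be empty, and then its supremum is the achievable rate `0`)
  let T : ℝ → Set ℕ := fun ρ => {r | (r : ℝ) ≤ η * Real.logb 2 ρ ∧ Achievable h ρ (fun _ => r) 1}
  have hbdd : ∀ ρ, BddAbove (T ρ) := fun ρ =>
    ⟨⌊η * Real.logb 2 ρ⌋₊, fun r hr => Nat.le_floor hr.1⟩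
  have hmem : ∀ ρ, 1 ≤ ρ → sSup (T ρ) ∈ T ρ := by
    intro ρ hρ
    refine Nat.sSup_mem ⟨0, ?_, ?_⟩ (hbdd ρ)
    · have := Real.logb_nonneg (b := 2) (by norm_num) hρ
      simp only [Nat.cast_zero]
      positivity
    · simpa using achievable_zero h (by linarith : 0 < ρ)
  refine ⟨fun ρ => ((sSup (T ρ) : ℕ) : ℝ), ?_, ?_⟩
  · intro ρ hρ
    rcases (T ρ).eq_empty_or_nonempty with h0 | h0
    · simpa [h0] using achievable_zero h hρ
    · exact (Nat.sSup_mem h0 (hbdd ρ)).2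
  · have hlog : Tendsto (fun ρ : ℝ => Real.logb 2 ρ) atTop atTop :=
      Real.tendsto_logb_atTop (by norm_num)
    refine tendsto_order.2 ⟨fun η' hη' => ?_, fun η' hη' => ?_⟩
    · obtain ⟨η'', h1, h2⟩ := exists_between hη'
      obtain ⟨C, hC⟩ := exists_const_achievable hK h hal h2
      filter_upwards [eventually_ge_atTop 1, hlog.eventually_gt_atTop 0,
        hlog.eventually_gt_atTop ((|C| + 1) / (η'' - η'))] with ρ hρ hl0 hl
      rw [lt_div_iff₀ hl0]
      rw [div_lt_iff₀ (by linarith)] at hl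
      have hCabs := le_abs_self C
      have hkey : η'' * Real.logb 2 ρ - |C| - 1 ≤ (sSup (T ρ) : ℕ) := by
        rcases le_or_gt (η'' * Real.logb 2 ρ - |C|) 0 with hneg | hpos
        · have : (0 : ℝ) ≤ (sSup (T ρ) : ℕ) := Nat.cast_nonneg _
          linarith
        · have hfl := Nat.floor_le hpos.le
          have hin : ⌊η'' * Real.logb 2 ρ - |C|⌋₊ ∈ T ρ := by
            refine ⟨?_, hC ρ hρ _ (by linarith)⟩
            have := abs_nonneg C
            nlinarith
          have h3 : ((⌊η'' * Real.logb 2 ρ - |C|⌋₊ : ℕ) : ℝ) ≤ (sSup (T ρ) : ℕ) := by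
            exact_mod_cast le_csSup (hbdd ρ) hin
          have := Nat.lt_floor_add_one (η'' * Real.logb 2 ρ - |C|)
          linarith
      nlinarith
    · filter_upwards [eventually_ge_atTop 1, hlog.eventually_gt_atTop 0] with ρ hρ hl0
      refine lt_of_le_of_lt ?_ hη'
      rw [div_le_iff₀ hl0]
      exact (hmem ρ hρ).1

end SecrecyIC

end

theorem theorem1 {Ω : Type*} [MeasurableSpace Ω] (P : MeasureTheory.Measure Ω)
    [MeasureTheory.IsProbabilityMeasure P] (K : ℕ) (hK : 2 ≤ K)
    (h : Fin K → Fin K → ℕ → Ω → ℂ) (hmeas : ∀ i k f, Measurable (h i k f))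
    (hcont : SecrecyIC.ContinuouslyDistributed P h) :
    ∀ᵐ ω ∂P, SecrecyIC.SecureDoFAchievable (fun i k f => h i k f ω)
      (((K : ℝ) - 2) / (2 * (K : ℝ) - 2)) := by
  filter_upwards [ae_all_iff.2 fun m => SecrecyIC.ae_hasAlignment P h hmeas hcont m] with ω hω
  exact SecrecyIC.secureDoFAchievable_of_hasAlignment hK _ hω
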